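/- Let $G_{n,k}$ be the Grassmann manifold of $k$-dimensional complex subspaces $L\subset\mathbb{C}^n$, with the coordinate-wise actions of the algebraic torus $(\mathbb{C}^*)^n$ and of the compact torus $T^n\subset(\mathbb{C}^*)^n$. For $I\subset\{1,\dots,n\}$, $|I|=k$, let $P^I(A_L)$ be the Plücker coordinate of $L$, i.e. the $k\times k$ minor with rows $I$ of an $n\times k$ matrix $A_L$ whose columns form a basis of $L$, let $\Lambda_I\in\mathbb{R}^n$ be the indicator vector of $I$, and let $$\mu(L)=\frac{\sum_I |P^I(A_L)|^2\Lambda_I}{\sum_I |P^I(A_L)|^2}$$ be the moment map. For a set $\sigma$ of $k$-subsets of $\{1,\dots,n\}$ let $W_\sigma=\{L\in G_{n,k}: P^I(A_L)\neq 0 \iff I\in\sigma\}$ and assume that $W_\sigma$ is non-empty (it is then called a stratum). Let $\mathring P_\sigma$ be the relative interior of $P_\sigma=\mathrm{conv}\{\Lambda_I: I\in\sigma\}$, let $F_\sigma=W_\sigma/(\mathbb{C}^*)^n$ be the space of parameters with the quotient topology, and let $p_\sigma: W_\sigma/T^n\to F_\sigma$ be the canonical projection. Then the moment map $\mu$ induces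 a map $\hat\mu: W_\sigma/T^n\to\mathring P_\sigma$, and: 1. $\hat\mu$ is a locally trivial fiber bundle with fiber $F_\sigma$; 2. the map $h_\sigma=(\hat\mu,p_\sigma): W_\sigma/T^n\to\mathring P_\sigma\times F_\sigma$ is a homeomorphism; 3. the fiber $F_\sigma$ is an open algebraic variety: for some $m$ there are Laurent monomials $\prod_{I\in\sigma}(P^I)^{\omega_{j,I}}$, $1\le j\le m$, $\omega_{j,I}\in\mathbb{Z}$, in the Plücker coordinates that induce a well-defined homeomorphism of $F_\sigma$ onto a set of the form $\{c\in(\mathbb{C}^*)^m: f(c)=0 \text{ for all } f\in S,\ g(c)\neq 0\}$, where $S\subset\mathbb{C}[c_1,\dots,c_m]$ and $g\in\mathbb{C}[c_1,\dots,c_m]$. -/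

import Mathlib

noncomputable section

namespace GrassmannTorus

open Matrix

/-- The `k`-element subsets `I` of the `n`-element index set. -/
abbrev KSubset (n k : ℕ) : Type := {I : Finset (Fin n) // I.card = k}

/-- The Grassmannian `G_{n,k}`: the `k`-dimensional complex linear subspaces of `ℂⁿ`. -/
@[ext]
structure Gr (n k : ℕ) : Type where
  toSubmodule : Submodule ℂ (Fin n → ℂ)
  finrank_eq : Module.finrank ℂ toSubmodule = k

/-- The `n × k` matrices of rank `k`, that is, with linearly independent columns. -/
abbrev Frame (n k : ℕ) : Type := {A : Matrix (Fin n) (Fin k) ℂ // LinearIndependent ℂ A.col}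

variable {n k : ℕ}

/-- The subspace spanned by the columns of a matrix of rank `k`. -/
def Frame.span (A : Frame n k) : Gr n k :=
  ⟨Submodule.span ℂ (Set.range A.1.col), by
    simpa using finrank_span_eq_card A.2⟩

/-- The usual (manifold) topology of `G_{n,k}`: the quotient topology under the map that sends a
matrix of rank `k` to its column space. -/
instance (n k : ℕ) : TopologicalSpace (Gr n k) :=
  TopologicalSpace.coinduced Frame.span inferInstance

theorem Frame.span_surjective : Function.Surjective (Frame.span : Frame n k → Gr n k) := by
  rintro ⟨L, hL⟩
  let b := Module.finBasisOfFinrankEq ℂ L hL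
  have hcol : (Matrix.of fun i j => (b j : Fin n → ℂ) i).col = fun j => (b j : Fin n → ℂ) := rfl
  have hli : LinearIndependent ℂ (fun j => (b j : Fin n → ℂ)) :=
    b.linearIndependent.map' L.subtype (Submodule.ker_subtype L)
  refine ⟨⟨Matrix.of fun i j => (b j : Fin n → ℂ) i, by rw [hcol]; exact hli⟩, Gr.ext ?_⟩
  change Submodule.span ℂ (Set.range fun j => (b j : Fin n → ℂ)) = L
  have h := congrArg (Submodule.map L.subtype) b.span_eq
  rw [Submodule.map_span, ← Set.range_comp, Submodule.map_top, Submodule.range_subtype] at h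
  exact h

/-- A matrix `A_L` whose columns form a basis of `L`. -/
def Gr.frame (L : Gr n k) : Frame n k := (Frame.span_surjective L).choose

theorem Gr.span_frame (L : Gr n k) : L.frame.span = L := (Frame.span_surjective L).choose_spec

/-- The Plücker coordinate `P^I(A)`: the `k × k` minor of `A` given by the rows indexed by `I`. -/
def plucker (A : Matrix (Fin n) (Fin k) ℂ) (I : KSubset n k) : ℂ :=
  (A.submatrix (I.1.orderEmbOfFin I.2) id).det

theorem plucker_mul (A : Matrix (Fin n) (Fin k) ℂ) (g : Matrix (Fin k) (Fin k) ℂ)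
    (I : KSubset n k) : plucker (A * g) I = plucker A I * g.det := by
  unfold plucker
  rw [← Matrix.det_mul]
  rfl

theorem exists_mul_of_span_le (A B : Frame n k) (h : A.span = B.span) :
    ∃ g : Matrix (Fin k) (Fin k) ℂ, A.1 = B.1 * g := by
  have hmem : ∀ j, A.1.col j ∈ Submodule.span ℂ (Set.range B.1.col) := fun j => by
    have h' : A.span.toSubmodule = B.span.toSubmodule := congrArg Gr.toSubmodule h
    change _ ∈ B.span.toSubmodule
    rw [← h']
    exact Submodule.subset_span ⟨j, rfl⟩
  choose c hc using fun j => (Submodule.mem_span_range_iff_exists_fun ℂ).1 (hmem j)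
  refine ⟨Matrix.of fun i j => c j i, ?_⟩
  ext i j
  have := congrFun (hc j) i
  simp only [Finset.sum_apply, Pi.smul_apply, Matrix.col_apply, smul_eq_mul] at this
  rw [← this, Matrix.mul_apply]
  exact Finset.sum_congr rfl fun l _ => mul_comm _ _

/-- The Plücker coordinates of a subspace are defined uniquely up to a common non-zero scalar. -/
theorem plucker_unique (A B : Frame n k) (h : A.span = B.span) :
    ∃ c : ℂ, c ≠ 0 ∧ ∀ I, plucker A.1 I = plucker B.1 I * c := by
  obtain ⟨g, hg⟩ := exists_mul_of_span_le A B h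
  refine ⟨g.det, ?_, fun I => by rw [hg, plucker_mul]⟩
  intro h0
  obtain ⟨v, hv, hgv⟩ := Matrix.exists_mulVec_eq_zero_iff.2 h0
  apply hv
  have hA : A.1 *ᵥ v = 0 := by rw [hg, ← Matrix.mulVec_mulVec, hgv, Matrix.mulVec_zero]
  exact (Matrix.mulVec_injective_iff.2 A.2) (by rw [hA, Matrix.mulVec_zero])

/-- The algebraic torus `(ℂ^*)ⁿ`. -/
abbrev AlgTorus (n : ℕ) : Type := Fin n → ℂˣ

/-- The compact torus `Tⁿ ⊂ (ℂ^*)ⁿ`. -/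
def compactTorus (n : ℕ) : Subgroup (AlgTorus n) where
  carrier := {t | ∀ i, ‖(t i : ℂ)‖ = 1}
  one_mem' := fun i => by simp
  mul_mem' := fun {s t} hs ht i => by simp [hs i, ht i]
  inv_mem' := fun {t} ht i => by simp [ht i]

/-- The coordinate-wise action of `t ∈ (ℂ^*)ⁿ` on `ℂⁿ`. -/
def scale (t : AlgTorus n) : (Fin n → ℂ) ≃ₗ[ℂ] (Fin n → ℂ) where
  toFun x i := (t i : ℂ) * x i
  invFun x i := ((t i)⁻¹ : ℂˣ) * x i
  map_add' x y := by ext i; simp [mul_add]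
  map_smul' c x := by ext i; simp [mul_left_comm]
  left_inv x := by ext i; simp
  right_inv x := by ext i; simp

/-- The canonical action of `(ℂ^*)ⁿ` on `G_{n,k}`: `t • L = {t x : x ∈ L}`. -/
instance : MulAction (AlgTorus n) (Gr n k) where
  smul t L := ⟨L.toSubmodule.map (scale t).toLinearMap, (LinearEquiv.finrank_map_eq (scale t) L.toSubmodule).trans L.finrank_eq⟩
  one_smul L := by
    refine Gr.ext ?_
    change L.toSubmodule.map (scale 1).toLinearMap = L.toSubmodule
    have h : (scale (1 : AlgTorus n)).toLinearMap = LinearMap.id := by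
      ext x i; simp [scale]
    rw [h, Submodule.map_id]
  mul_smul s t L := by
    refine Gr.ext ?_
    change L.toSubmodule.map (scale (s * t)).toLinearMap
      = (L.toSubmodule.map (scale t).toLinearMap).map (scale s).toLinearMap
    rw [← Submodule.map_comp]
    congr 1
    ext x i; simp [scale, mul_assoc]

/-- The matrix `A` with its `i`-th row multiplied by `t_i`. -/
def Frame.scale (t : AlgTorus n) (A : Frame n k) : Frame n k :=
  ⟨Matrix.of fun i j => (t i : ℂ) * A.1 i j,
    A.2.map' (GrassmannTorus.scale t).toLinearMap (LinearEquiv.ker _)⟩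

theorem Frame.span_scale (t : AlgTorus n) (A : Frame n k) : (A.scale t).span = t • A.span := by
  refine Gr.ext ?_
  change _ = Submodule.map _ (Submodule.span ℂ (Set.range A.1.col))
  rw [Submodule.map_span, ← Set.range_comp]
  rfl

theorem plucker_scale (t : AlgTorus n) (A : Frame n k) (I : KSubset n k) :
    plucker (A.scale t).1 I = (∏ i, (t (I.1.orderEmbOfFin I.2 i) : ℂ)) * plucker A.1 I := by
  unfold plucker
  rw [← Matrix.det_mul_column]
  rfl

theorem plucker_smul (t : AlgTorus n) (L : Gr n k) :
    ∃ c : ℂ, c ≠ 0 ∧ ∀ I : KSubset n k, plucker (t • L).frame.1 I =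
      (∏ i, (t (I.1.orderEmbOfFin I.2 i) : ℂ)) * plucker L.frame.1 I * c := by
  obtain ⟨c, hc, h⟩ := plucker_unique (t • L).frame (L.frame.scale t)
    (by rw [Gr.span_frame, Frame.span_scale, Gr.span_frame])
  exact ⟨c, hc, fun I => by rw [h, plucker_scale]⟩

/-- The weight vector `Λ_I ∈ ℝⁿ`, the indicator vector of `I`. -/
def weight (I : KSubset n k) : Fin n → ℝ := fun j => if j ∈ I.1 then 1 else 0

/-- The moment map `μ(L) = (∑_I |P^I(A_L)|² Λ_I) / (∑_I |P^I(A_L)|²)`. -/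
def momentMap (L : Gr n k) : Fin n → ℝ :=
  (∑ I : KSubset n k, ‖plucker L.frame.1 I‖ ^ 2)⁻¹ •
    ∑ I : KSubset n k, ‖plucker L.frame.1 I‖ ^ 2 • weight I

theorem moment_aux (p q : KSubset n k → ℂ) (c : ℂ) (hc : c ≠ 0)
    (h : ∀ I, ‖p I‖ = ‖q I‖ * ‖c‖) :
    (∑ I, ‖p I‖ ^ 2)⁻¹ • ∑ I, ‖p I‖ ^ 2 • weight I =
      (∑ I, ‖q I‖ ^ 2)⁻¹ • ∑ I, ‖q I‖ ^ 2 • weight I := by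
  have hc2 : ‖c‖ ^ 2 ≠ 0 := pow_ne_zero 2 (norm_ne_zero_iff.2 hc)
  have h2 : ∀ I, ‖p I‖ ^ 2 = ‖c‖ ^ 2 * ‖q I‖ ^ 2 := fun I => by rw [h]; ring
  simp only [h2, mul_smul, ← Finset.mul_sum, ← Finset.smul_sum, mul_inv]
  rw [smul_comm, inv_smul_smul₀ hc2]

/-- The moment map may be computed from any matrix representing the subspace. -/
theorem momentMap_span (A : Frame n k) :
    momentMap A.span = (∑ I : KSubset n k, ‖plucker A.1 I‖ ^ 2)⁻¹ •
      ∑ I : KSubset n k, ‖plucker A.1 I‖ ^ 2 • weight I := by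
  obtain ⟨c, hc, h⟩ := plucker_unique A.span.frame A (Gr.span_frame _)
  exact moment_aux _ _ c hc fun I => by rw [h, norm_mul]

/-- The moment map is `Tⁿ`-invariant. -/
theorem momentMap_smul (t : compactTorus n) (L : Gr n k) :
    momentMap ((t : AlgTorus n) • L) = momentMap L := by
  obtain ⟨c, hc, h⟩ := plucker_smul (t : AlgTorus n) L
  have ht : ∀ i, ‖((t : AlgTorus n) i : ℂ)‖ = 1 := t.2
  exact moment_aux _ _ c hc fun I => by rw [h]; simp [ht]

/-- The set `W_σ` of all `L` with `P^I(L) ≠ 0` exactly for `I ∈ σ`, together with the action of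
`(ℂ^*)ⁿ` on it. It is a stratum if it is non-empty. -/
def stratum (σ : Finset (KSubset n k)) : SubMulAction (AlgTorus n) (Gr n k) where
  carrier := {L | ∀ I, plucker L.frame.1 I ≠ 0 ↔ I ∈ σ}
  smul_mem' t L hL := fun I => by
    obtain ⟨c, hc, h⟩ := plucker_smul t L
    rw [← hL I, h]
    simp [hc, Finset.prod_eq_zero_iff]

theorem span_mem_stratum (σ : Finset (KSubset n k)) (A : Frame n k) :
    A.span ∈ stratum σ ↔ ∀ I, plucker A.1 I ≠ 0 ↔ I ∈ σ := by
  obtain ⟨c, hc, h⟩ := plucker_unique A.span.frame A (Gr.span_frame _)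
  change (∀ I, plucker A.span.frame.1 I ≠ 0 ↔ I ∈ σ) ↔ _
  simp [h, hc]

/-- The orbit space `W_σ / Tⁿ`, with the quotient topology. -/
abbrev OrbitSpace (σ : Finset (KSubset n k)) : Type :=
  Quotient (MulAction.orbitRel (compactTorus n) (stratum σ))

/-- The space of parameters `F_σ = W_σ / (ℂ^*)ⁿ`, with the quotient topology. -/
abbrev ParamSpace (σ : Finset (KSubset n k)) : Type :=
  Quotient (MulAction.orbitRel (AlgTorus n) (stratum σ))

/-- The map on `W_σ / Tⁿ` induced by the moment map. -/
def momentHat (σ : Finset (KSubset n k)) : OrbitSpace σ → (Fin n → ℝ) :=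
  Quotient.lift (fun L : stratum σ => momentMap (L : Gr n k)) (by
    rintro _ L ⟨t, rfl⟩
    exact momentMap_smul t L.1)

/-- The canonical projection `p_σ : W_σ / Tⁿ → F_σ`. -/
def paramProj (σ : Finset (KSubset n k)) : OrbitSpace σ → ParamSpace σ :=
  Quotient.map' id (by
    rintro _ L ⟨t, rfl⟩
    exact ⟨(t : AlgTorus n), rfl⟩)

/-- The polytope `P_σ`, the convex hull of the `Λ_I` with `I ∈ σ`. -/
def polytope (σ : Finset (KSubset n k)) : Set (Fin n → ℝ) :=
  convexHull ℝ (weight '' (σ : Set (KSubset n k)))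

/-- The (relative) interior of the polytope `P_σ`. -/
def openPolytope (σ : Finset (KSubset n k)) : Set (Fin n → ℝ) :=
  intrinsicInterior ℝ (polytope σ)

/-- The principal Zariski open subset `g ≠ 0` of the algebraic subset of `(ℂ^*)^m` cut out by the
equations `f = 0`, `f ∈ S`. -/
def openAlgebraicSubset (m : ℕ) (S : Set (MvPolynomial (Fin m) ℂ)) (g : MvPolynomial (Fin m) ℂ) :
    Set (Fin m → ℂ) :=
  {c | (∀ j, c j ≠ 0) ∧ (∀ f ∈ S, MvPolynomial.eval c f = 0) ∧ MvPolynomial.eval c g ≠ 0}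

end GrassmannTorus

end

noncomputable section

namespace GrassmannTorus

open Matrix

/-! ### Plücker coordinates and reconstruction of a subspace from them -/

section

variable {n k : ℕ}

/-! A torus element `t` with `|t_i|² = exp b_i` multiplies `|P^I|²` by `exp ⟨b, Λ_I⟩`. With `w_I`
the normalised `|P^I(L)|²`, the equation `μ(t • L) = x` therefore says that `b` is a critical point
of the convex function `b ↦ ∑ w_I exp ⟨b, Λ_I - x⟩`. For `x` in the relative interior of `P_σ` this
function is coercive on the direction space of `P_σ` and has exactly one minimum there, which
depends continuously on `x` and `L` (`exists_continuous_sum_exp_eq_zero`). This gives surjectivity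
of `h_σ` and continuity of its inverse. Two solutions in one orbit differ by a vector orthogonal to
every `Λ_I - x`, hence, up to a common scalar, by phases on the coordinates in `σ`
(`phase_smul_eq_of_momentMap_eq`); this is injectivity. The homeomorphism `h_σ` is then a global
trivialization of the moment map.

For the parameter space, take a basis of the lattice of exponents whose Laurent monomials are
invariant under torus and scalars. As `ℂ^*` is divisible, these monomials separate the orbits
(`exists_proportional_of_laurentHom_eq`); as the lattice is a direct summand, they have a section `c
↦ p(c)` by ordinary monomials (`exists_monomials`). So `F_σ` becomes the set of `c` for which `p(c)`
is a Plücker vector. Rebuilding a matrix from one chart `I₀` turns this condition into polynomial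
equations (`plucker_chartMatrix`, `plucker_inv_smul_chartMatrix`), and the rebuilt matrix gives a
continuous inverse. -/

theorem exists_minor_eq_sum_plucker (f : Fin k → Fin n) :
    ∃ c : KSubset n k → ℤ, ∀ A : Matrix (Fin n) (Fin k) ℂ,
      (A.submatrix f id).det = ∑ I, (c I : ℂ) * plucker A I := by
  classical
  -- Distinct rows are a permutation of the rows of one `I`, so the minor is `±P^I`; with a repeated
  -- row it is `0`. The coefficients do not depend on `A`.
  by_cases hf : Function.Injective f
  · let I : KSubset n k :=
      ⟨Finset.univ.image f, by simp [Finset.card_image_of_injective _ hf]⟩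
    have hmem : ∀ i, f i ∈ I.1 := fun i => Finset.mem_image_of_mem _ (Finset.mem_univ i)
    let τ : Fin k → Fin k := fun i => (I.1.orderIsoOfFin I.2).symm ⟨f i, hmem i⟩
    have hτ : ∀ i, I.1.orderEmbOfFin I.2 (τ i) = f i := fun i => by
      rw [← Finset.coe_orderIsoOfFin_apply]
      simp [τ]
    have hinj : Function.Injective τ := fun i j h => hf (by rw [← hτ, ← hτ, h])
    let e : Equiv.Perm (Fin k) := Equiv.ofBijective τ (Finite.injective_iff_bijective.1 hinj)
    refine ⟨fun J => if J = I then (Equiv.Perm.sign e : ℤ) else 0, fun A => ?_⟩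
    rw [Finset.sum_eq_single I (by intro J _ h; simp [h]) (by simp)]
    have : A.submatrix f id = (A.submatrix (I.1.orderEmbOfFin I.2) id).submatrix e id := by
      ext i j
      simp [e, hτ]
    rw [this, Matrix.det_permute]
    simp [plucker]
  · refine ⟨0, fun A => ?_⟩
    simp only [Function.Injective, not_forall] at hf
    obtain ⟨i, j, h, hij⟩ := hf
    rw [Matrix.det_zero_of_row_eq hij (by ext l; simp [h])]
    simp

/-- The integers that express the minor with rows `f 0, f 1, …` by the Plücker coordinates. -/
def minorCoeff (f : Fin k → Fin n) : KSubset n k → ℤ := (exists_minor_eq_sum_plucker f).choose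

theorem det_submatrix_eq (f : Fin k → Fin n) (A : Matrix (Fin n) (Fin k) ℂ) :
    (A.submatrix f id).det = ∑ I, (minorCoeff f I : ℂ) * plucker A I :=
  (exists_minor_eq_sum_plucker f).choose_spec A

/-- The `k × k` submatrix of `A` with rows `I`. -/
abbrev rowBlock (A : Matrix (Fin n) (Fin k) ℂ) (I : KSubset n k) : Matrix (Fin k) (Fin k) ℂ :=
  A.submatrix (I.1.orderEmbOfFin I.2) id

/-- The matrix whose entries are, up to sign, the coordinates `p_J` for the sets `J` that differ
from `I` in at most one element. -/
def chartMatrix {R : Type*} [CommRing R] (I : KSubset n k) (p : KSubset n k → R) :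
    Matrix (Fin n) (Fin k) R :=
  Matrix.of fun j i =>
    ∑ J, (minorCoeff (Function.update (I.1.orderEmbOfFin I.2) i j) J : R) * p J

/-- Cramer's rule: replacing row `i` of the block by row `j` of `A` and taking the determinant gives
an entry of `A` times the adjugate. No division occurs, so the matrix is polynomial in the Plücker
coordinates. -/
theorem chartMatrix_plucker (I : KSubset n k) (A : Matrix (Fin n) (Fin k) ℂ) :
    chartMatrix I (plucker A) = A * (rowBlock A I).adjugate := by
  ext j i
  simp only [chartMatrix, Matrix.of_apply]
  rw [← det_submatrix_eq]
  have h1 : A.submatrix (Function.update (I.1.orderEmbOfFin I.2) i j) id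
      = (rowBlock A I).updateRow i (A j) := by
    ext a b
    by_cases h : a = i
    · subst h; simp
    · simp [Function.update_of_ne h, Matrix.updateRow_ne h]
  rw [h1, ← Matrix.cramer_transpose_apply, Matrix.cramer_eq_adjugate_mulVec,
    ← Matrix.adjugate_transpose, Matrix.mulVec_transpose]
  rfl

theorem chartMatrix_mul {R : Type*} [CommRing R] (I : KSubset n k) (p : KSubset n k → R) (c : R) :
    chartMatrix I (fun J => p J * c) = c • chartMatrix I p := by
  ext j i
  simp only [chartMatrix, Matrix.of_apply, Matrix.smul_apply, smul_eq_mul, Finset.mul_sum]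
  exact Finset.sum_congr rfl fun J _ => by ring

theorem chartMatrix_map {R S : Type*} [CommRing R] [CommRing S] (φ : R →+* S) (I : KSubset n k)
    (p : KSubset n k → R) : (chartMatrix I p).map φ = chartMatrix I fun J => φ (p J) := by
  ext j i
  simp [chartMatrix]

/-- Inclusion of column spaces of the same dimension `k` is equality, so `g` need not be assumed
invertible. -/
theorem span_eq_of_eq_mul (A B : Frame n k) (g : Matrix (Fin k) (Fin k) ℂ) (h : A.1 = B.1 * g) :
    A.span = B.span := by
  refine Gr.ext (Submodule.eq_of_le_of_finrank_eq ?_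
    (A.span.finrank_eq.trans B.span.finrank_eq.symm))
  change Submodule.span ℂ _ ≤ Submodule.span ℂ _
  rw [Submodule.span_le]
  rintro _ ⟨j, rfl⟩
  rw [SetLike.mem_coe, Submodule.mem_span_range_iff_exists_fun]
  refine ⟨fun l => g l j, ?_⟩
  ext i
  simp only [Finset.sum_apply, Pi.smul_apply, Matrix.col_apply, smul_eq_mul, h, Matrix.mul_apply]
  exact Finset.sum_congr rfl fun l _ => mul_comm _ _

/-- A subspace is determined by its Plücker coordinates. -/
theorem span_eq_of_plucker_eq (A B : Frame n k) (I : KSubset n k) (hI : plucker A.1 I ≠ 0) (c : ℂ)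
    (h : ∀ J, plucker A.1 J = plucker B.1 J * c) : A.span = B.span := by
  have hA := chartMatrix_plucker I A.1
  rw [funext h, chartMatrix_mul, chartMatrix_plucker] at hA
  have hA' := congrArg (· * rowBlock A.1 I) hA
  simp only [Matrix.mul_assoc, Matrix.adjugate_mul] at hA'
  have hdet : (rowBlock A.1 I).det ≠ 0 := hI
  -- The witness solves `det(A_I) • A = c • B * adj(B_I) * A_I`, obtained by multiplying the chart
  -- identity by `A_I` on the right.
  refine span_eq_of_eq_mul A B
    ((rowBlock A.1 I).det⁻¹ • c • ((rowBlock B.1 I).adjugate * rowBlock A.1 I)) ?_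
  rw [Matrix.mul_smul, Matrix.mul_smul, ← Matrix.mul_assoc, ← Matrix.smul_mul, Matrix.mul_assoc,
    Matrix.smul_mul, Matrix.mul_assoc] at *
  rw [hA']
  simp [smul_smul, hdet]

/-- As in Cauchy–Binet: for a left inverse `B` of `A`, expanding `det (B * A) = 1` in the rows gives
a combination of minors of `A`. -/
theorem exists_plucker_ne_zero (A : Frame n k) : ∃ I, plucker A.1 I ≠ 0 := by
  by_contra! h0
  obtain ⟨g, hg⟩ := LinearMap.exists_leftInverse_of_injective (Matrix.toLin' A.1)
    (LinearMap.ker_eq_bot.2 (Matrix.mulVec_injective_iff.2 A.2))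
  let B : Matrix (Fin k) (Fin n) ℂ := LinearMap.toMatrix' g
  have hBA : B * A.1 = 1 := by
    have := congrArg LinearMap.toMatrix' hg
    rwa [LinearMap.toMatrix'_comp, LinearMap.toMatrix'_toLin', LinearMap.toMatrix'_id] at this
  have hrow : B * A.1 = fun i => ∑ j, B i j • A.1 j := by
    ext i l
    simp [Matrix.mul_apply]
  have hdet : (B * A.1).det = 0 := by
    rw [hrow]
    change (Matrix.detRowAlternating (R := ℂ) (n := Fin k)).toMultilinearMap _ = 0
    rw [MultilinearMap.map_sum]
    refine Finset.sum_eq_zero fun f _ => ?_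
    rw [MultilinearMap.map_smul_univ]
    change _ • (A.1.submatrix f id).det = 0
    rw [det_submatrix_eq]
    simp [h0]
  rw [hBA, Matrix.det_one] at hdet
  exact one_ne_zero hdet

theorem linearIndependent_col_of_plucker_ne_zero (A : Matrix (Fin n) (Fin k) ℂ) (I : KSubset n k)
    (h : plucker A I ≠ 0) : LinearIndependent ℂ A.col := by
  rw [← Matrix.mulVec_injective_iff]
  intro v w hvw
  have hinj : Function.Injective (rowBlock A I).mulVec := by
    rw [Matrix.mulVec_injective_iff_isUnit, Matrix.isUnit_iff_isUnit_det]
    exact isUnit_iff_ne_zero.2 h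
  apply hinj
  ext i
  exact congrFun hvw (I.1.orderEmbOfFin I.2 i)

theorem plucker_smul_matrix (A : Matrix (Fin n) (Fin k) ℂ) (c : ℂ) (I : KSubset n k) :
    plucker (c • A) I = c ^ k * plucker A I := by
  change (c • rowBlock A I).det = _
  rw [Matrix.det_smul, Fintype.card_fin]
  rfl

/-- Equations satisfied by the vectors `p = c • P(A)` of Plücker coordinates. -/
theorem plucker_chartMatrix (A : Matrix (Fin n) (Fin k) ℂ) (c : ℂ) (I J : KSubset n k) :
    plucker (chartMatrix I fun J => plucker A J * c) J * (plucker A I * c) =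
      plucker A J * c * (plucker A I * c) ^ k := by
  rw [chartMatrix_mul, plucker_smul_matrix, chartMatrix_plucker, plucker_mul]
  -- The extra factor `plucker A I` avoids the exponent `k - 1`, so `k = 0` needs no separate
  -- treatment.
  have h : (rowBlock A I).adjugate.det * plucker A I = plucker A I ^ k := by
    change _ * (rowBlock A I).det = (rowBlock A I).det ^ k
    rw [← Matrix.det_mul, Matrix.adjugate_mul, Matrix.det_smul, Matrix.det_one, mul_one,
      Fintype.card_fin]
  linear_combination c ^ k * plucker A J * c * h

/-- Converse of `plucker_chartMatrix`: a solution of the equations with `p I ≠ 0` is, up to scale,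
the Plücker vector of an explicit matrix. -/
theorem plucker_inv_smul_chartMatrix (p : KSubset n k → ℂ) (I : KSubset n k) (hI : p I ≠ 0)
    (h : ∀ J, plucker (chartMatrix I p) J * p I = p J * p I ^ k) (J : KSubset n k) :
    plucker ((p I)⁻¹ • chartMatrix I p) J = p J * (p I)⁻¹ := by
  rw [plucker_smul_matrix, inv_pow, inv_mul_eq_iff_eq_mul₀ (pow_ne_zero _ hI)]
  field_simp
  rw [h, mul_comm]

theorem continuous_plucker (I : KSubset n k) :
    Continuous fun A : Matrix (Fin n) (Fin k) ℂ => plucker A I :=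
  (continuous_id.matrix_submatrix _ _).matrix_det

end

/-! ### Topology of the Grassmannian, the torus action and the moment map -/

section

variable {n k : ℕ}

/-- The right action of an invertible matrix on the matrices of rank `k`. -/
def Frame.mulUnit (g : (Matrix (Fin k) (Fin k) ℂ)ˣ) (A : Frame n k) : Frame n k :=
  ⟨A.1 * g.1, by
    rw [← Matrix.mulVec_injective_iff]
    intro v w h
    simp only [← Matrix.mulVec_mulVec] at h
    exact Matrix.mulVec_injective_iff_isUnit.2 g.isUnit (Matrix.mulVec_injective_iff.2 A.2 h)⟩

theorem Frame.span_mulUnit (g : (Matrix (Fin k) (Fin k) ℂ)ˣ) (A : Frame n k) :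
    (A.mulUnit g).span = A.span :=
  span_eq_of_eq_mul _ _ g.1 rfl

theorem Frame.continuous_mulUnit (g : (Matrix (Fin k) (Fin k) ℂ)ˣ) :
    Continuous (Frame.mulUnit g : Frame n k → Frame n k) :=
  (continuous_subtype_val.matrix_mul continuous_const).subtype_mk _

theorem Frame.exists_mulUnit_eq (A B : Frame n k) (h : A.span = B.span) :
    ∃ g, A = B.mulUnit g := by
  obtain ⟨g, hg⟩ := exists_mul_of_span_le A B h
  have hu : IsUnit g := by
    rw [← Matrix.mulVec_injective_iff_isUnit]
    intro v w hvw
    apply Matrix.mulVec_injective_iff.2 A.2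
    simp only [hg, ← Matrix.mulVec_mulVec, hvw]
  exact ⟨hu.unit, Subtype.ext hg⟩

theorem Frame.continuous_span : Continuous (Frame.span : Frame n k → Gr n k) :=
  continuous_coinduced_rng

/-- The saturation of an open set is a union of its preimages under right multiplication by
invertible matrices. Openness matters because open quotient maps are stable under products and under
restriction to the preimage of a stratum. -/
theorem Frame.isOpenQuotientMap_span : IsOpenQuotientMap (Frame.span : Frame n k → Gr n k) := by
  refine ⟨Frame.span_surjective, continuous_span, fun U hU => ?_⟩
  change IsOpen (Frame.span ⁻¹' (Frame.span '' U))
  have : Frame.span ⁻¹' (Frame.span '' U) = ⋃ g, Frame.mulUnit (n := n) g ⁻¹' U := by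
    ext A
    simp only [Set.mem_preimage, Set.mem_image, Set.mem_iUnion]
    constructor
    · rintro ⟨B, hB, h⟩
      obtain ⟨g, rfl⟩ := Frame.exists_mulUnit_eq B A h
      exact ⟨g, hB⟩
    · rintro ⟨g, hg⟩
      exact ⟨_, hg, Frame.span_mulUnit g A⟩
  rw [this]
  exact isOpen_iUnion fun g => hU.preimage (Frame.continuous_mulUnit g)

instance : ContinuousSMul (AlgTorus n) (Gr n k) where
  continuous_smul := by
    have hq : IsOpenQuotientMap (Prod.map (id : AlgTorus n → AlgTorus n)
        (Frame.span : Frame n k → Gr n k)) :=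
      IsOpenQuotientMap.id.prodMap Frame.isOpenQuotientMap_span
    rw [hq.isQuotientMap.continuous_iff]
    have h : Continuous fun x : AlgTorus n × Frame n k => x.2.scale x.1 := by
      refine Continuous.subtype_mk (continuous_matrix fun i j => ?_) _
      exact (Units.continuous_val.comp ((continuous_apply i).comp continuous_fst)).mul
        ((continuous_subtype_val.comp continuous_snd).matrix_elem i j)
    convert Frame.continuous_span.comp h using 1
    ext1 x
    exact (Frame.span_scale x.1 x.2).symm

instance (σ : Finset (KSubset n k)) : ContinuousSMul (AlgTorus n) (stratum σ) where
  continuous_smul :=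
    (continuous_fst.smul (continuous_subtype_val.comp continuous_snd)).subtype_mk _

instance (σ : Finset (KSubset n k)) : ContinuousConstSMul (compactTorus n) (stratum σ) where
  continuous_const_smul t := continuous_const_smul (t : AlgTorus n)

/-- The sum of the squared absolute values of the Plücker coordinates. -/
def pluckerNormSq (A : Matrix (Fin n) (Fin k) ℂ) : ℝ := ∑ I : KSubset n k, ‖plucker A I‖ ^ 2

theorem pluckerNormSq_pos (A : Frame n k) : 0 < pluckerNormSq A.1 := by
  obtain ⟨I, hI⟩ := exists_plucker_ne_zero A
  exact Finset.sum_pos' (fun _ _ => by positivity)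
    ⟨I, Finset.mem_univ _, by have := norm_pos_iff.2 hI; positivity⟩

/-- The normalised squared absolute values of the Plücker coordinates. -/
def pluckerWeight (L : Gr n k) (I : KSubset n k) : ℝ :=
  (pluckerNormSq L.frame.1)⁻¹ * ‖plucker L.frame.1 I‖ ^ 2

theorem pluckerWeight_eq_of_proportional (A B : Matrix (Fin n) (Fin k) ℂ) (c : ℂ) (hc : c ≠ 0)
    (h : ∀ I, plucker A I = plucker B I * c) (I : KSubset n k) :
    (pluckerNormSq A)⁻¹ * ‖plucker A I‖ ^ 2 = (pluckerNormSq B)⁻¹ * ‖plucker B I‖ ^ 2 := by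
  have hc' : ‖c‖ ≠ 0 := norm_ne_zero_iff.2 hc
  simp only [pluckerNormSq, h, norm_mul, mul_pow, ← Finset.sum_mul]
  field_simp

theorem pluckerWeight_span (A : Frame n k) (I : KSubset n k) :
    pluckerWeight A.span I = (pluckerNormSq A.1)⁻¹ * ‖plucker A.1 I‖ ^ 2 := by
  obtain ⟨c, hc, h⟩ := plucker_unique A.span.frame A (Gr.span_frame _)
  exact pluckerWeight_eq_of_proportional _ _ c hc h I

theorem continuous_pluckerWeight (I : KSubset n k) :
    Continuous fun L : Gr n k => pluckerWeight L I := by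
  rw [Frame.isOpenQuotientMap_span.isQuotientMap.continuous_iff]
  have h : Continuous fun A : Frame n k => (pluckerNormSq A.1)⁻¹ * ‖plucker A.1 I‖ ^ 2 := by
    refine Continuous.mul (Continuous.inv₀ ?_ fun A => (pluckerNormSq_pos A).ne') ?_
    · exact continuous_finsetSum _ fun J _ =>
        ((continuous_plucker J).comp continuous_subtype_val).norm.pow 2
    · exact ((continuous_plucker I).comp continuous_subtype_val).norm.pow 2
  convert h using 1
  ext1 A
  exact pluckerWeight_span A I

theorem sum_pluckerWeight (L : Gr n k) : ∑ I, pluckerWeight L I = 1 := by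
  simp only [pluckerWeight, ← Finset.mul_sum]
  exact inv_mul_cancel₀ (pluckerNormSq_pos L.frame).ne'

theorem momentMap_eq_sum (L : Gr n k) : momentMap L = ∑ I, pluckerWeight L I • weight I := by
  simp only [momentMap, pluckerWeight, mul_smul, Finset.smul_sum]
  rfl

theorem continuous_momentMap : Continuous (momentMap : Gr n k → Fin n → ℝ) := by
  rw [funext momentMap_eq_sum]
  exact continuous_finsetSum _ fun I _ => (continuous_pluckerWeight I).smul continuous_const

variable {σ : Finset (KSubset n k)}

theorem pluckerWeight_pos {L : Gr n k} (hL : L ∈ stratum σ) {I : KSubset n k} (hI : I ∈ σ) :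
    0 < pluckerWeight L I := by
  have h1 := norm_pos_iff.2 ((hL I).2 hI)
  have h2 := pluckerNormSq_pos L.frame
  unfold pluckerWeight
  positivity

theorem pluckerWeight_eq_zero {L : Gr n k} (hL : L ∈ stratum σ) {I : KSubset n k} (hI : I ∉ σ) :
    pluckerWeight L I = 0 := by
  have h1 : plucker L.frame.1 I = 0 := by
    by_contra h
    exact hI ((hL I).1 h)
  simp [pluckerWeight, h1]

theorem nonempty_of_mem_stratum {L : Gr n k} (hL : L ∈ stratum σ) : σ.Nonempty := by
  obtain ⟨I, hI⟩ := exists_plucker_ne_zero L.frame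
  exact ⟨I, (hL I).1 hI⟩

theorem sum_eq_sum_stratum {E : Type*} [AddCommGroup E] [Module ℝ E] {L : Gr n k}
    (hL : L ∈ stratum σ) (f : KSubset n k → E) :
    ∑ I, pluckerWeight L I • f I = ∑ I ∈ σ, pluckerWeight L I • f I :=
  (Finset.sum_subset (Finset.subset_univ σ) fun I _ hI => by
    rw [pluckerWeight_eq_zero hL hI, zero_smul]).symm

/-- The factor by which the action of a torus element changes the `I`-th Plücker coordinate. -/
def character (t : AlgTorus n) (I : KSubset n k) : ℂ := ∏ i ∈ I.1, (t i : ℂ)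

theorem prod_orderEmbOfFin {M : Type*} [CommMonoid M] (I : KSubset n k) (f : Fin n → M) :
    ∏ i, f (I.1.orderEmbOfFin I.2 i) = ∏ i ∈ I.1, f i := by
  conv_rhs => rw [← Finset.map_orderEmbOfFin_univ I.1 I.2, Finset.prod_map]
  rfl

theorem exists_plucker_smul_frame (t : AlgTorus n) (L : Gr n k) :
    ∃ c : ℂ, c ≠ 0 ∧ ∀ I : KSubset n k,
      plucker (t • L).frame.1 I = character t I * plucker L.frame.1 I * c := by
  obtain ⟨c, hc, h⟩ := plucker_smul t L
  exact ⟨c, hc, fun I => by rw [h, prod_orderEmbOfFin I fun i => (t i : ℂ), character]⟩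

/-- A torus element carries `L` to `L'` if it does so for the Plücker coordinates, up to a scalar. -/
theorem smul_eq_of_character {L L' : Gr n k} (t : AlgTorus n) (c : ℂ)
    (h : ∀ I, plucker L'.frame.1 I = c * (character t I * plucker L.frame.1 I)) : t • L = L' := by
  obtain ⟨d, hd, h'⟩ := exists_plucker_smul_frame t L
  obtain ⟨I, hI⟩ := exists_plucker_ne_zero L'.frame
  rw [← Gr.span_frame (t • L), ← Gr.span_frame L', eq_comm]
  refine span_eq_of_plucker_eq _ _ I hI (d⁻¹ * c) fun J => ?_
  rw [h, h']
  field_simp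

theorem norm_character_eq_exp (t : AlgTorus n) (b : Fin n → ℝ)
    (hb : ∀ i, ‖(t i : ℂ)‖ ^ 2 = Real.exp (b i)) (I : KSubset n k) :
    ‖character t I‖ ^ 2 = Real.exp (b ⬝ᵥ weight I) := by
  rw [character, norm_prod, ← Finset.prod_pow, Finset.prod_congr rfl fun i _ => hb i,
    ← Real.exp_sum]
  congr 1
  simp [dotProduct, weight, Finset.sum_ite_mem]

/-- The weights of `t • L` are proportional to those of `L` times `‖character t I‖ ^ 2`. Since
weights sum to `1`, subtracting `x` inside the sum removes the denominator. -/
theorem momentMap_smul_eq_iff (t : AlgTorus n) (L : Gr n k) (x : Fin n → ℝ) :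
    momentMap (t • L) = x ↔
      ∑ I, (pluckerWeight L I * ‖character t I‖ ^ 2) • (weight I - x) = 0 := by
  obtain ⟨c, hc, h⟩ := exists_plucker_smul_frame t L
  set N := pluckerNormSq (t • L).frame.1 with hN
  have hNpos : 0 < N := pluckerNormSq_pos _
  have hLpos := pluckerNormSq_pos L.frame
  have hc' : ‖c‖ ≠ 0 := norm_ne_zero_iff.2 hc
  have hw : ∀ I, pluckerWeight L I * ‖character t I‖ ^ 2 =
      ((pluckerNormSq L.frame.1)⁻¹ * (‖c‖ ^ 2)⁻¹ * N) * pluckerWeight (t • L) I := fun I => by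
    rw [pluckerWeight, pluckerWeight, h, ← hN, norm_mul, norm_mul]
    field_simp
  simp only [hw, mul_smul, ← Finset.smul_sum]
  rw [smul_eq_zero_iff_right (by positivity), smul_eq_zero_iff_right (by positivity),
    smul_eq_zero_iff_right (by positivity)]
  simp only [smul_sub, Finset.sum_sub_distrib, ← momentMap_eq_sum, ← Finset.sum_smul,
    sum_pluckerWeight, one_smul, sub_eq_zero]

end

/-! ### Convex analysis: the moment equation as a minimisation problem -/

section

section ConvexAnalysis

open Filter Topology

/-- By compactness, for `x` near `x₀` the value at `a x₀` stays below all values on a small sphere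
around it. By convexity a minimiser on or beyond that sphere would force a value on it no larger
than the one at its centre. -/
theorem continuous_argmin {X V : Type*} [TopologicalSpace X] [NormedAddCommGroup V]
    [NormedSpace ℝ V] [ProperSpace V] (Φ : X → V → ℝ) (hΦ : Continuous fun z : X × V => Φ z.1 z.2)
    (hconv : ∀ x, ConvexOn ℝ Set.univ (Φ x)) (a : X → V)
    (ha : ∀ x b, b ≠ a x → Φ x (a x) < Φ x b) : Continuous a := by
  rw [continuous_iff_continuousAt]
  intro x₀
  rw [ContinuousAt, Metric.tendsto_nhds]
  intro ε hε
  have h1 : ∀ᶠ x in 𝓝 x₀, ∀ b ∈ Metric.sphere (a x₀) ε, Φ x (a x₀) < Φ x b := by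
    refine (isCompact_sphere (a x₀) ε).eventually_forall_of_forall_eventually fun b hb => ?_
    have hne : b ≠ a x₀ := by
      rintro rfl
      simp at hb
      exact hε.ne hb
    have hc : Continuous fun z : X × V => Φ z.1 (a x₀) :=
      hΦ.comp (continuous_fst.prodMk continuous_const)
    exact (hc.tendsto _).eventually_lt (hΦ.tendsto _) (ha x₀ b hne)
  filter_upwards [h1] with x hx
  by_contra! hdist
  rw [dist_eq_norm] at hdist
  have hd : 0 < ‖a x - a x₀‖ := hε.trans_le hdist
  -- Chosen so that the segment from `a x₀` to `a x` meets the sphere at parameter `t`.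
  set t := ε / ‖a x - a x₀‖ with ht
  have ht0 : 0 < t := by positivity
  have ht1 : t ≤ 1 := (div_le_one hd).2 hdist
  have hb := hx ((1 - t) • a x₀ + t • a x) (by
    have : (1 - t) • a x₀ + t • a x - a x₀ = t • (a x - a x₀) := by module
    rw [mem_sphere_iff_norm, this, norm_smul, Real.norm_of_nonneg ht0.le, ht,
      div_mul_cancel₀ _ hd.ne'])
  have h2 := (hconv x).2 (Set.mem_univ (a x₀)) (Set.mem_univ (a x)) (sub_nonneg.2 ht1) ht0.le
    (by ring)
  have h3 : Φ x (a x) ≤ Φ x (a x₀) := by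
    by_cases h : a x₀ = a x
    · rw [h]
    · exact (ha x _ h).le
  simp only [smul_eq_mul] at h2
  nlinarith

variable {ι : Type*} {n : ℕ} (p : ι → Fin n → ℝ)

theorem exists_ball_subset_of_mem_intrinsicInterior {x : Fin n → ℝ}
    (hx : x ∈ intrinsicInterior ℝ (convexHull ℝ (Set.range p))) :
    (∀ i, p i - x ∈ vectorSpan ℝ (Set.range p)) ∧
    ∃ ε > 0, ∀ v ∈ vectorSpan ℝ (Set.range p), ‖v‖ < ε → x + v ∈ convexHull ℝ (Set.range p) := by
  obtain ⟨⟨y, hy⟩, hyint, rfl⟩ := mem_intrinsicInterior.1 hx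
  have hdir : (affineSpan ℝ (convexHull ℝ (Set.range p))).direction
      = vectorSpan ℝ (Set.range p) := by
    rw [affineSpan_convexHull, direction_affineSpan]
  refine ⟨fun i => ?_, ?_⟩
  · rw [← hdir]
    exact AffineSubspace.vsub_mem_direction
      (subset_affineSpan ℝ _ (subset_convexHull ℝ _ ⟨i, rfl⟩)) hy
  · rw [mem_interior_iff_mem_nhds, Metric.mem_nhds_iff] at hyint
    obtain ⟨ε, hε, hsub⟩ := hyint
    refine ⟨ε, hε, fun v hv hvε => ?_⟩
    have hmem : y + v ∈ affineSpan ℝ (convexHull ℝ (Set.range p)) := by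
      rw [add_comm]
      exact AffineSubspace.vadd_mem_of_mem_direction (hdir ▸ hv) hy
    exact hsub (show (⟨y + v, hmem⟩ : affineSpan ℝ (convexHull ℝ (Set.range p))) ∈ _ by
      rw [Metric.mem_ball, Subtype.dist_eq, dist_eq_norm]
      simpa using hvε)

variable [Fintype ι]

/-- Coefficient vectors of sum zero map linearly onto the direction space, and a surjective linear
map in finite dimension is open. -/
theorem exists_small_combination {η : ℝ} (hη : 0 < η) :
    ∃ δ > 0, ∀ v ∈ vectorSpan ℝ (Set.range p), ‖v‖ < δ →
      ∃ c : ι → ℝ, ∑ i, c i = 0 ∧ (∀ i, |c i| < η) ∧ v = ∑ i, c i • p i := by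
  classical
  let K : Submodule ℝ (ι → ℝ) := LinearMap.ker (Fintype.linearCombination ℝ (fun _ : ι => (1 : ℝ)))
  have hK : ∀ c : ι → ℝ, c ∈ K ↔ ∑ i, c i = 0 := fun c => by
    simp [K, Fintype.linearCombination_apply]
  let T : K →ₗ[ℝ] (Fin n → ℝ) := (Fintype.linearCombination ℝ p).comp K.subtype
  have hT : ∀ c : K, T c = ∑ i, c.1 i • p i := fun c => by
    simp [T, Fintype.linearCombination_apply]
  have hopen := LinearMap.isOpenMap_of_finiteDimensional T.rangeRestrict T.surjective_rangeRestrict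
  have hU : IsOpen (Metric.ball (0 : K) η) := Metric.isOpen_ball
  have h0 : (0 : LinearMap.range T) ∈ T.rangeRestrict '' Metric.ball (0 : K) η :=
    ⟨0, by simpa using hη, map_zero _⟩
  obtain ⟨δ, hδ, hsub⟩ := Metric.isOpen_iff.1 (hopen _ hU) 0 h0
  refine ⟨δ, hδ, fun v hv hvδ => ?_⟩
  have hvT : v ∈ LinearMap.range T := by
    obtain ⟨s, w, hw, rfl⟩ := (mem_vectorSpan_iff_eq_weightedVSub ℝ).1 hv
    refine ⟨⟨fun i => if i ∈ s then w i else 0, (hK _).2 (by simpa using hw)⟩, ?_⟩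
    rw [hT, Finset.weightedVSub_eq_linear_combination _ hw]
    simp [ite_smul]
  obtain ⟨c, hc, hcv⟩ := hsub (show (⟨v, hvT⟩ : LinearMap.range T) ∈ _ by simpa using hvδ)
  refine ⟨c.1, (hK _).1 c.2, fun i => ?_, ?_⟩
  · rw [mem_ball_zero_iff] at hc
    exact (norm_le_pi_norm c.1 i).trans_lt hc
  · rw [← hT]
    exact (congrArg Subtype.val hcv).symm

/-- Positive weights stay positive under zero-sum perturbations smaller than the least weight, and
these perturbations fill a neighbourhood in the affine span. -/
theorem sum_smul_mem_intrinsicInterior (w : ι → ℝ) (hw : ∀ i, 0 < w i) (hsum : ∑ i, w i = 1) :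
    ∑ i, w i • p i ∈ intrinsicInterior ℝ (convexHull ℝ (Set.range p)) := by
  have hmem : ∀ c : ι → ℝ, (∀ i, 0 ≤ c i) → ∑ i, c i = 1 →
      ∑ i, c i • p i ∈ convexHull ℝ (Set.range p) := fun c h0 h1 =>
    (convex_convexHull ℝ _).sum_mem (fun i _ => h0 i) h1
      fun i _ => subset_convexHull ℝ _ ⟨i, rfl⟩
  have hx := hmem w (fun i => (hw i).le) hsum
  have hne : (Finset.univ : Finset ι).Nonempty := by
    rw [Finset.nonempty_iff_ne_empty]
    intro h
    simp [h] at hsum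
  obtain ⟨i₀, -, hi₀⟩ := Finset.exists_min_image Finset.univ w hne
  obtain ⟨δ, hδ, h⟩ := exists_small_combination p (hw i₀)
  refine mem_intrinsicInterior.2 ⟨⟨_, subset_affineSpan ℝ _ hx⟩, ?_, rfl⟩
  rw [mem_interior_iff_mem_nhds, Metric.mem_nhds_iff]
  refine ⟨δ, hδ, ?_⟩
  rintro ⟨y, hy⟩ hyδ
  have hv : y - ∑ i, w i • p i ∈ vectorSpan ℝ (Set.range p) := by
    have := AffineSubspace.vsub_mem_direction hy (subset_affineSpan ℝ _ hx)
    rwa [affineSpan_convexHull, direction_affineSpan] at this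
  obtain ⟨c, hc0, hcη, hc⟩ := h _ hv (by
    rw [← dist_eq_norm]
    exact hyδ)
  have hy' : y = ∑ i, (w i + c i) • p i := by
    simp only [add_smul, Finset.sum_add_distrib, ← hc]
    abel
  change y ∈ convexHull ℝ (Set.range p)
  rw [hy']
  refine hmem _ (fun i => ?_) (by rw [Finset.sum_add_distrib, hsum, hc0, add_zero])
  have h1 := (abs_lt.1 (hcη i)).1
  have h2 := hi₀ i (Finset.mem_univ i)
  linarith

theorem norm_sq_le_dotProduct (a : Fin n → ℝ) : ‖a‖ ^ 2 ≤ a ⬝ᵥ a := by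
  have h0 : 0 ≤ a ⬝ᵥ a := Finset.sum_nonneg fun i _ => mul_self_nonneg _
  rw [← Real.le_sqrt (norm_nonneg _) h0, pi_norm_le_iff_of_nonneg (Real.sqrt_nonneg _)]
  intro i
  rw [Real.norm_eq_abs, ← Real.sqrt_mul_self_eq_abs]
  exact Real.sqrt_le_sqrt
    (Finset.single_le_sum (f := fun i => a i * a i) (fun i _ => mul_self_nonneg _)
      (Finset.mem_univ i))

/-- Coercivity: otherwise a half-space orthogonal to `a` contains the whole hull but misses a point
`x + v` of it, where `v` is a short multiple of `a`. -/
theorem exists_norm_le_dotProduct {x : Fin n → ℝ}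
    (hx : x ∈ intrinsicInterior ℝ (convexHull ℝ (Set.range p))) :
    ∃ ε > 0, ∀ a ∈ vectorSpan ℝ (Set.range p), ∃ i, ε * ‖a‖ ≤ a ⬝ᵥ (p i - x) := by
  obtain ⟨-, ε, hε, h⟩ := exists_ball_subset_of_mem_intrinsicInterior p hx
  refine ⟨ε / 2, by positivity, fun a ha => ?_⟩
  by_contra! hlt
  -- If `a = 0`, division by zero gives `v = 0`, and the contradiction is reached at `x` itself.
  set v : Fin n → ℝ := (ε / 2 / ‖a‖) • a with hv
  have hnorm : ‖v‖ < ε := by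
    rw [hv, norm_smul, Real.norm_of_nonneg (by positivity)]
    by_cases h0 : ‖a‖ = 0
    · rw [h0]
      simpa using hε
    · rw [div_mul_cancel₀ _ h0]
      linarith
  have hmem := h v (Submodule.smul_mem _ _ ha) hnorm
  have hle : ε / 2 * ‖a‖ ≤ a ⬝ᵥ v := by
    rw [hv, dotProduct_smul, smul_eq_mul]
    by_cases h0 : ‖a‖ = 0
    · simp [h0]
    · have : ε / 2 * ‖a‖ = ε / 2 / ‖a‖ * ‖a‖ ^ 2 := by field_simp
      rw [this]
      exact mul_le_mul_of_nonneg_left (norm_sq_le_dotProduct a) (by positivity)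
  have hlin : IsLinearMap ℝ fun y : Fin n → ℝ => a ⬝ᵥ y :=
    ⟨dotProduct_add a, fun c y => dotProduct_smul c a y⟩
  have hsub : convexHull ℝ (Set.range p) ⊆ {y | a ⬝ᵥ y < a ⬝ᵥ (x + v)} := by
    refine convexHull_min ?_ (convex_halfSpace_lt hlin _)
    rintro _ ⟨i, rfl⟩
    have := hlt i
    rw [dotProduct_sub] at this
    simp only [Set.mem_ofPred_eq, dotProduct_add]
    linarith
  exact lt_irrefl (a ⬝ᵥ (x + v)) (hsub hmem)

/-- Pairing the difference of the two equations with `b` gives `∑ w_i (exp u_i - 1) u_i = 0`, whose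
terms are nonnegative and vanish only for `u_i = 0`. It yields both uniqueness of the minimum and
injectivity of `h_σ`. -/
theorem dotProduct_eq_zero_of_sum_exp_eq_zero (x b : Fin n → ℝ) (w : ι → ℝ) (hw : ∀ i, 0 < w i)
    (h0 : ∑ i, w i • (p i - x) = 0)
    (h1 : ∑ i, (w i * Real.exp (b ⬝ᵥ (p i - x))) • (p i - x) = 0) (i : ι) :
    b ⬝ᵥ (p i - x) = 0 := by
  have h0' := congrArg (b ⬝ᵥ ·) h0
  have h1' := congrArg (b ⬝ᵥ ·) h1
  simp only [dotProduct_sum, dotProduct_smul, dotProduct_zero, smul_eq_mul] at h0' h1'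
  have hmono : ∀ u : ℝ, 0 ≤ (Real.exp u - 1) * u ∧ ((Real.exp u - 1) * u = 0 → u = 0) := by
    intro u
    rcases lt_trichotomy u 0 with h | h | h
    · have := Real.exp_lt_one_iff.2 h
      have h' := mul_pos_of_neg_of_neg (sub_neg.2 this) h
      exact ⟨h'.le, fun h'' => absurd h'' h'.ne'⟩
    · simp [h]
    · have := Real.one_lt_exp_iff.2 h
      have h' := mul_pos (sub_pos.2 this) h
      exact ⟨h'.le, fun h'' => absurd h'' h'.ne'⟩
  have hsum : ∑ i, w i * ((Real.exp (b ⬝ᵥ (p i - x)) - 1) * (b ⬝ᵥ (p i - x))) = 0 := by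
    rw [← sub_eq_zero.2 (h1'.trans h0'.symm), ← Finset.sum_sub_distrib]
    exact Finset.sum_congr rfl fun i _ => by ring
  have := (Finset.sum_eq_zero_iff_of_nonneg fun i _ =>
    mul_nonneg (hw i).le (hmono _).1).1 hsum i (Finset.mem_univ i)
  exact (hmono _).2 ((mul_eq_zero.1 this).resolve_left (hw i).ne')

/-- The convex function of `a` whose critical point gives the point of an orbit with moment `x`. -/
def expSum (x : Fin n → ℝ) (w : ι → ℝ) (a : Fin n → ℝ) : ℝ :=
  ∑ i, w i * Real.exp (a ⬝ᵥ (p i - x))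

theorem convexOn_expSum (x : Fin n → ℝ) (w : ι → ℝ) (hw : ∀ i, 0 < w i) :
    ConvexOn ℝ Set.univ (expSum p x w) := by
  refine ⟨convex_univ, fun a _ b _ s t hs ht hst => ?_⟩
  simp only [expSum, smul_eq_mul, Finset.mul_sum, ← Finset.sum_add_distrib]
  refine Finset.sum_le_sum fun i _ => ?_
  have := convexOn_exp.2 (Set.mem_univ (a ⬝ᵥ (p i - x))) (Set.mem_univ (b ⬝ᵥ (p i - x))) hs ht hst
  simp only [smul_eq_mul] at this
  rw [add_dotProduct, smul_dotProduct, smul_dotProduct, smul_eq_mul, smul_eq_mul]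
  have := mul_le_mul_of_nonneg_left this (hw i).le
  linarith

/-- The gradient `v` lies in the direction space itself, so a minimum over that space may be tested
along `v`; the derivative there is `v ⬝ᵥ v`. -/
theorem sum_exp_eq_zero_of_isMin (x : Fin n → ℝ) (w : ι → ℝ)
    (hx : ∀ i, p i - x ∈ vectorSpan ℝ (Set.range p)) (a : vectorSpan ℝ (Set.range p))
    (ha : ∀ b : vectorSpan ℝ (Set.range p), expSum p x w a ≤ expSum p x w b) :
    ∑ i, (w i * Real.exp ((a : Fin n → ℝ) ⬝ᵥ (p i - x))) • (p i - x) = 0 := by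
  set v := ∑ i, (w i * Real.exp ((a : Fin n → ℝ) ⬝ᵥ (p i - x))) • (p i - x) with hv
  have hvV : v ∈ vectorSpan ℝ (Set.range p) :=
    Submodule.sum_mem _ fun i _ => Submodule.smul_mem _ _ (hx i)
  have hder : HasDerivAt (fun t : ℝ => expSum p x w (a + t • v)) (v ⬝ᵥ v) 0 := by
    have h1 : ∀ i, HasDerivAt
        (fun t : ℝ => w i * Real.exp (((a : Fin n → ℝ) + t • v) ⬝ᵥ (p i - x)))
        (w i * Real.exp ((a : Fin n → ℝ) ⬝ᵥ (p i - x)) * (v ⬝ᵥ (p i - x))) 0 := fun i => by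
      have h2 : HasDerivAt (fun t : ℝ => ((a : Fin n → ℝ) + t • v) ⬝ᵥ (p i - x))
          (v ⬝ᵥ (p i - x)) 0 := by
        simp only [add_dotProduct, smul_dotProduct, smul_eq_mul]
        simpa using ((hasDerivAt_id (0 : ℝ)).mul_const (v ⬝ᵥ (p i - x))).const_add
          ((a : Fin n → ℝ) ⬝ᵥ (p i - x))
      simpa [mul_assoc] using h2.exp.const_mul (w i)
    have h3 := HasDerivAt.fun_sum fun i (_ : i ∈ Finset.univ) => h1 i
    have h4 : v ⬝ᵥ v =
        ∑ i, w i * Real.exp ((a : Fin n → ℝ) ⬝ᵥ (p i - x)) * (v ⬝ᵥ (p i - x)) := by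
      conv_lhs => rw [hv, ← hv, dotProduct_sum]
      simp only [dotProduct_smul, smul_eq_mul]
    rw [h4]
    exact h3
  have hmin : IsLocalMin (fun t : ℝ => expSum p x w (a + t • v)) 0 := by
    refine Filter.Eventually.of_forall fun t => ?_
    simpa using ha ⟨a + t • v, Submodule.add_mem _ a.2 (Submodule.smul_mem _ _ hvV)⟩
  exact dotProduct_self_eq_zero.1 (hmin.hasDerivAt_eq_zero hder)

theorem continuous_expSum {X : Type*} [TopologicalSpace X] {x : X → Fin n → ℝ} {w : X → ι → ℝ}
    {a : X → Fin n → ℝ} (hx : Continuous x) (hw : Continuous w) (ha : Continuous a) :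
    Continuous fun z => expSum p (x z) (w z) (a z) := by
  unfold expSum dotProduct
  fun_prop

/-- Existence is coercivity. For uniqueness, the difference of two minimisers is orthogonal to the
direction space that contains it. -/
theorem exists_isMin_expSum (x : Fin n → ℝ)
    (hx : x ∈ intrinsicInterior ℝ (convexHull ℝ (Set.range p))) (w : ι → ℝ) (hw : ∀ i, 0 < w i) :
    ∃ a : vectorSpan ℝ (Set.range p), ∀ b : vectorSpan ℝ (Set.range p), b ≠ a →
      expSum p x w a < expSum p x w b := by
  obtain ⟨ε, hε, hcoer⟩ := exists_norm_le_dotProduct p hx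
  have hne : (Finset.univ : Finset ι).Nonempty := by
    obtain ⟨i, -⟩ := hcoer 0 (Submodule.zero_mem _)
    exact ⟨i, Finset.mem_univ i⟩
  obtain ⟨i₀, -, hi₀⟩ := Finset.exists_min_image Finset.univ w hne
  have htend : Tendsto (fun a : vectorSpan ℝ (Set.range p) => expSum p x w a)
      (cocompact _) atTop := by
    have h1 : Tendsto (fun a : vectorSpan ℝ (Set.range p) => w i₀ * ε * ‖a‖) (cocompact _) atTop :=
      (tendsto_norm_cocompact_atTop).const_mul_atTop (mul_pos (hw i₀) hε)
    refine tendsto_atTop_mono (fun a => ?_) h1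
    obtain ⟨i, hi⟩ := hcoer a a.2
    have h2 : w i * Real.exp ((a : Fin n → ℝ) ⬝ᵥ (p i - x)) ≤ expSum p x w a :=
      Finset.single_le_sum (f := fun i => w i * Real.exp ((a : Fin n → ℝ) ⬝ᵥ (p i - x)))
        (fun i _ => mul_nonneg (hw i).le (Real.exp_pos _).le) (Finset.mem_univ i)
    refine le_trans ?_ h2
    have h3 := Real.add_one_le_exp ((a : Fin n → ℝ) ⬝ᵥ (p i - x))
    rw [mul_assoc]
    refine mul_le_mul (hi₀ i (Finset.mem_univ i)) ?_ (by positivity) (hw i).le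
    change ε * ‖(a : Fin n → ℝ)‖ ≤ _
    linarith
  have hcont : Continuous fun a : vectorSpan ℝ (Set.range p) => expSum p x w a :=
    continuous_expSum p continuous_const continuous_const continuous_subtype_val
  obtain ⟨a, ha⟩ := hcont.exists_forall_le htend
  have hV := (exists_ball_subset_of_mem_intrinsicInterior p hx).1
  refine ⟨a, fun b hb => lt_of_le_of_ne (ha b) fun heq => hb ?_⟩
  have ga := sum_exp_eq_zero_of_isMin p x w hV a ha
  have gb := sum_exp_eq_zero_of_isMin p x w hV b fun c => heq ▸ ha c
  -- Absorbing `exp (a ⬝ᵥ (p i - x))` into the weights moves the minimiser `a` to the origin.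
  have horth := dotProduct_eq_zero_of_sum_exp_eq_zero p x ((b : Fin n → ℝ) - (a : Fin n → ℝ))
    (fun i => w i * Real.exp ((a : Fin n → ℝ) ⬝ᵥ (p i - x)))
    (fun i => mul_pos (hw i) (Real.exp_pos _)) ga (by
      rw [← gb]
      refine Finset.sum_congr rfl fun i _ => ?_
      rw [mul_assoc, ← Real.exp_add, ← add_dotProduct]
      simp)
  have hle : vectorSpan ℝ (Set.range p) ≤
      LinearMap.ker (dotProductBilin ℝ ℝ ((b : Fin n → ℝ) - (a : Fin n → ℝ))) := by
    refine (vectorSpan_def ℝ _).le.trans (Submodule.span_le.2 ?_)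
    rintro _ ⟨_, ⟨i, rfl⟩, _, ⟨j, rfl⟩, rfl⟩
    have hi := horth i
    have hj := horth j
    rw [dotProduct_sub] at hi hj
    change ((b : Fin n → ℝ) - (a : Fin n → ℝ)) ⬝ᵥ (p i - p j) = 0
    rw [dotProduct_sub]
    linarith
  have hself : ((b : Fin n → ℝ) - (a : Fin n → ℝ)) ⬝ᵥ ((b : Fin n → ℝ) - (a : Fin n → ℝ)) = 0 :=
    hle (Submodule.sub_mem _ b.2 a.2)
  exact Subtype.ext (sub_eq_zero.1 (dotProduct_self_eq_zero.1 hself))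

/-- Convex duality with parameters: the solution of the moment equation depends continuously on
the data. -/
theorem exists_continuous_sum_exp_eq_zero {X : Type*} [TopologicalSpace X] (x : X → Fin n → ℝ)
    (hx : Continuous x) (hxP : ∀ z, x z ∈ intrinsicInterior ℝ (convexHull ℝ (Set.range p)))
    (w : X → ι → ℝ) (hw : Continuous w) (hwpos : ∀ z i, 0 < w z i) :
    ∃ a : X → Fin n → ℝ, Continuous a ∧
      ∀ z, ∑ i, (w z i * Real.exp (a z ⬝ᵥ (p i - x z))) • (p i - x z) = 0 := by
  choose a ha using fun z => exists_isMin_expSum p (x z) (hxP z) (w z) (hwpos z)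
  refine ⟨fun z => a z, continuous_subtype_val.comp ?_, fun z => ?_⟩
  · refine continuous_argmin
      (fun z (b : vectorSpan ℝ (Set.range p)) => expSum p (x z) (w z) b) ?_ (fun z => ?_) a ha
    · exact continuous_expSum p (hx.comp continuous_fst) (hw.comp continuous_fst)
        (continuous_subtype_val.comp continuous_snd)
    · exact (convexOn_expSum p (x z) (w z) (hwpos z)).comp_linearMap
        (vectorSpan ℝ (Set.range p)).subtype
  · refine sum_exp_eq_zero_of_isMin p _ _
      (exists_ball_subset_of_mem_intrinsicInterior p (hxP z)).1 _ fun b => ?_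
    by_cases h : b = a z
    · rw [h]
    · exact (ha z b h).le

end ConvexAnalysis

end

/-! ### The homeomorphism from the orbit space to polytope times parameters -/

section

variable {n k : ℕ} {σ : Finset (KSubset n k)}

theorem polytope_eq (σ : Finset (KSubset n k)) :
    polytope σ = convexHull ℝ (Set.range fun I : σ => weight I.1) := by
  rw [polytope, Set.image_eq_range]
  rfl

theorem momentMap_mem_openPolytope {L : Gr n k} (hL : L ∈ stratum σ) :
    momentMap L ∈ openPolytope σ := by
  rw [openPolytope, polytope_eq, momentMap_eq_sum, sum_eq_sum_stratum hL,
    ← Finset.sum_coe_sort σ fun I => pluckerWeight L I • weight I]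
  refine sum_smul_mem_intrinsicInterior (fun I : σ => weight I.1) (fun I => pluckerWeight L I.1)
    (fun I => pluckerWeight_pos hL I.2) ?_
  have h := sum_eq_sum_stratum hL fun _ => (1 : ℝ)
  simp only [smul_eq_mul, mul_one, sum_pluckerWeight] at h
  rw [Finset.sum_coe_sort σ fun I => pluckerWeight L I, ← h]

/-- The moment equation on an orbit, for a torus element with given absolute values. -/
theorem momentMap_smul_eq_iff_sum_exp {L : Gr n k} (hL : L ∈ stratum σ) (t : AlgTorus n)
    (b : Fin n → ℝ) (hb : ∀ i, ‖(t i : ℂ)‖ ^ 2 = Real.exp (b i)) (x : Fin n → ℝ) :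
    momentMap (t • L) = x ↔
      ∑ I : σ, (pluckerWeight L I.1 * Real.exp (b ⬝ᵥ (weight I.1 - x))) • (weight I.1 - x) = 0 := by
  have h1 : ∀ I, (pluckerWeight L I * ‖character t I‖ ^ 2) • (weight I - x) =
      Real.exp (b ⬝ᵥ x) • (pluckerWeight L I • Real.exp (b ⬝ᵥ (weight I - x)) • (weight I - x)) :=
    fun I => by
    rw [norm_character_eq_exp t b hb, dotProduct_sub, Real.exp_sub, smul_smul, smul_smul]
    congr 1
    have := Real.exp_ne_zero (b ⬝ᵥ x)
    field_simp
  simp only [momentMap_smul_eq_iff, h1, ← Finset.smul_sum]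
  rw [smul_eq_zero_iff_right (Real.exp_ne_zero _), sum_eq_sum_stratum hL]
  simp only [mul_smul]
  rw [Finset.sum_coe_sort σ fun I =>
    pluckerWeight L I • Real.exp (b ⬝ᵥ (weight I - x)) • (weight I - x)]

/-- The element of the torus with coordinates `exp (b_i / 2)`. -/
def expTorus (b : Fin n → ℝ) : AlgTorus n := fun i =>
  Units.mk0 (Complex.exp ((b i / 2 : ℝ) : ℂ)) (Complex.exp_ne_zero _)

theorem norm_expTorus_sq (b : Fin n → ℝ) (i : Fin n) :
    ‖(expTorus b i : ℂ)‖ ^ 2 = Real.exp (b i) := by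
  rw [expTorus, Units.val_mk0, Complex.norm_exp_ofReal, ← Real.exp_nat_mul]
  congr 1
  push_cast
  ring

theorem continuous_expTorus : Continuous (expTorus : (Fin n → ℝ) → AlgTorus n) := by
  refine continuous_pi fun i => Units.continuous_iff.2 ⟨?_, ?_⟩
  · change Continuous fun b : Fin n → ℝ => Complex.exp ((b i / 2 : ℝ) : ℂ)
    fun_prop
  · change Continuous fun b : Fin n → ℝ => (((expTorus b i)⁻¹ : ℂˣ) : ℂ)
    simp only [Units.val_inv_eq_inv_val, expTorus, Units.val_mk0, ← Complex.exp_neg]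
    fun_prop

/-- The phase `t / |t|` of a torus element. -/
def phase (t : AlgTorus n) : AlgTorus n := fun i =>
  Units.mk0 ((t i : ℂ) / ‖(t i : ℂ)‖) (by simp)

theorem phase_mem (t : AlgTorus n) : phase t ∈ compactTorus n := fun i => by
  simp [phase]

theorem norm_mul_character_phase (t : AlgTorus n) (I : KSubset n k) :
    (‖character t I‖ : ℂ) * character (phase t) I = character t I := by
  simp only [character, phase, Units.val_mk0, norm_prod, Complex.ofReal_prod,
    ← Finset.prod_mul_distrib]
  refine Finset.prod_congr rfl fun i _ => ?_
  have : ((‖(t i : ℂ)‖ : ℝ) : ℂ) ≠ 0 := by simp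
  field_simp

/-- In an orbit of the algebraic torus the moment map separates the orbits of the compact torus. -/
theorem phase_smul_eq_of_momentMap_eq {L : Gr n k} (hL : L ∈ stratum σ) (t : AlgTorus n)
    (h : momentMap (t • L) = momentMap L) : phase t • L = t • L := by
  set x := momentMap L with hx
  have hpos : ∀ i, 0 < ‖(t i : ℂ)‖ ^ 2 := fun i => by
    have := norm_pos_iff.2 (t i).ne_zero
    positivity
  let b : Fin n → ℝ := fun i => Real.log (‖(t i : ℂ)‖ ^ 2)
  have hb : ∀ i, ‖(t i : ℂ)‖ ^ 2 = Real.exp (b i) := fun i => (Real.exp_log (hpos i)).symm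
  have h1 := (momentMap_smul_eq_iff_sum_exp hL t b hb x).1 h
  have h0 := (momentMap_smul_eq_iff_sum_exp hL 1 0 (by simp) x).1 (by rw [one_smul])
  simp only [zero_dotProduct, Real.exp_zero, mul_one] at h0
  have horth := dotProduct_eq_zero_of_sum_exp_eq_zero (fun I : σ => weight I.1) x b
    (fun I => pluckerWeight L I.1) (fun I => pluckerWeight_pos hL I.2) h0 h1
  -- Orthogonality makes `‖character t I‖` constant on `σ`; `t` and its phase thus act on the
  -- Plücker vector with the same result up to a scalar.
  have hchar : ∀ I ∈ σ, ‖character t I‖ = √(Real.exp (b ⬝ᵥ x)) := fun I hI => by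
    have := horth ⟨I, hI⟩
    rw [dotProduct_sub, sub_eq_zero] at this
    rw [← this, ← norm_character_eq_exp t b hb, Real.sqrt_sq (norm_nonneg _)]
  obtain ⟨d, hd, hpl⟩ := exists_plucker_smul_frame t L
  refine smul_eq_of_character (phase t) (d * (√(Real.exp (b ⬝ᵥ x)) : ℝ)) fun I => ?_
  rw [hpl]
  by_cases hI : I ∈ σ
  · rw [← hchar I hI]
    linear_combination (-d * plucker L.frame.1 I) * norm_mul_character_phase t I
  · have : plucker L.frame.1 I = 0 := by
      by_contra h'
      exact hI ((hL I).1 h')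
    simp [this]

theorem momentHat_mem (x : OrbitSpace σ) : momentHat σ x ∈ openPolytope σ := by
  induction x using Quotient.inductionOn with
  | h L => exact momentMap_mem_openPolytope L.2

/-- The map `h_σ` from the orbit space to the product of the open polytope with the space of
parameters. -/
def orbitToProd (σ : Finset (KSubset n k)) (x : OrbitSpace σ) : openPolytope σ × ParamSpace σ :=
  (⟨momentHat σ x, momentHat_mem x⟩, paramProj σ x)

theorem continuous_orbitToProd : Continuous (orbitToProd σ) := by
  refine Continuous.prodMk (Continuous.subtype_mk ?_ _) ?_
  · exact (continuous_momentMap.comp continuous_subtype_val).quotient_lift _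
  · exact continuous_id.quotient_map' _

theorem orbitToProd_injective : Function.Injective (orbitToProd σ) := by
  intro x y h
  induction x using Quotient.inductionOn with | h L => ?_
  induction y using Quotient.inductionOn with | h L' => ?_
  have h1 : momentMap L.1 = momentMap L'.1 := congrArg (fun z => z.1.1) h
  have h2 : (Quotient.mk _ L : ParamSpace σ) = Quotient.mk _ L' := congrArg Prod.snd h
  obtain ⟨t, rfl⟩ := Quotient.exact h2
  refine Quotient.sound ⟨⟨phase t, phase_mem t⟩, Subtype.ext ?_⟩
  exact phase_smul_eq_of_momentMap_eq L'.2 t h1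

/-- A continuous choice of points of prescribed moment in the orbits of the algebraic torus. -/
theorem exists_continuous_section (σ : Finset (KSubset n k)) :
    ∃ s : openPolytope σ × stratum σ → stratum σ, Continuous s ∧
      ∀ z, orbitToProd σ (Quotient.mk _ (s z)) = (z.1, Quotient.mk _ z.2) := by
  obtain ⟨a, hac, ha⟩ := exists_continuous_sum_exp_eq_zero (fun I : σ => weight I.1)
    (fun z : openPolytope σ × stratum σ => z.1.1) (continuous_subtype_val.comp continuous_fst)
    (fun z => by
      rw [← polytope_eq]
      exact z.1.2)
    (fun z I => pluckerWeight z.2.1 I.1)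
    (continuous_pi fun I =>
      (continuous_pluckerWeight I.1).comp (continuous_subtype_val.comp continuous_snd))
    (fun z I => pluckerWeight_pos z.2.2 I.2)
  refine ⟨fun z => expTorus (a z) • z.2, (continuous_expTorus.comp hac).smul continuous_snd,
    fun z => Prod.ext (Subtype.ext ?_) (Quotient.sound ⟨expTorus (a z), rfl⟩)⟩
  exact (momentMap_smul_eq_iff_sum_exp z.2.2 (expTorus (a z)) (a z) (norm_expTorus_sq _) z.1.1).2
    (ha z)

/-- The section depends on `L`, not only on its orbit, but injectivity makes its class descend.
Continuity of the inverse is tested upstairs, since the product of the identity with the orbit map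
is an open quotient map. -/
theorem isHomeomorph_orbitToProd : IsHomeomorph (orbitToProd σ) := by
  obtain ⟨s, hs, hsec⟩ := exists_continuous_section σ
  have hsurj : Function.Surjective (orbitToProd σ) := by
    rintro ⟨x, y⟩
    induction y using Quotient.inductionOn with
    | h L => exact ⟨_, hsec (x, L)⟩
  have hq : IsOpenQuotientMap (Prod.map (id : openPolytope σ → openPolytope σ)
      (Quotient.mk _ : stratum σ → ParamSpace σ)) :=
    IsOpenQuotientMap.id.prodMap MulAction.isOpenQuotientMap_quotientMk
  let E : OrbitSpace σ ≃ openPolytope σ × ParamSpace σ :=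
    Equiv.ofBijective _ ⟨orbitToProd_injective, hsurj⟩
  have hinv : Continuous E.symm := by
    rw [hq.isQuotientMap.continuous_iff]
    have : E.symm ∘ Prod.map id (Quotient.mk _) = fun z => Quotient.mk _ (s z) := by
      funext z
      exact E.symm_apply_eq.2 (hsec z).symm
    rw [this]
    exact continuous_quot_mk.comp hs
  exact (Homeomorph.mk E continuous_orbitToProd hinv).isHomeomorph

/-- A homeomorphism onto a product is a global trivialization of its first component. -/
def trivializationOfHomeomorph {Z B F : Type*} [TopologicalSpace Z] [TopologicalSpace B]
    [TopologicalSpace F] (e : Z ≃ₜ B × F) : Bundle.Trivialization F fun z => (e z).1 where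
  toOpenPartialHomeomorph := e.toOpenPartialHomeomorph
  baseSet := Set.univ
  open_baseSet := isOpen_univ
  source_eq := by simp
  target_eq := by simp
  proj_toFun _ _ := rfl

end

/-! ### Lattices of exponents and invariant Laurent monomials -/

section

section Lattice

/-- The kernel of a map of lattices has a basis whose dual basis extends to the whole lattice. -/
theorem exists_basis_ker {ι N : Type*} [Finite ι] [AddCommGroup N] [Module.Free ℤ N]
    [Module.Finite ℤ N] (φ : (ι → ℤ) →ₗ[ℤ] N) :
    ∃ (m : ℕ) (b : Module.Basis (Fin m) ℤ (LinearMap.ker φ)) (l : Fin m → (ι → ℤ) →ₗ[ℤ] ℤ),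
      ∀ i j, l j (b i) = if i = j then 1 else 0 := by
  let b := Module.finBasis ℤ (LinearMap.ker φ)
  -- The image of `φ` is a submodule of a free `ℤ`-module, hence projective; splitting it gives the
  -- retraction `r` onto the kernel.
  obtain ⟨s, hs⟩ := Module.projective_lifting_property φ.rangeRestrict LinearMap.id
    φ.surjective_rangeRestrict
  have hs' : ∀ y, φ (s y) = y := fun y => congrArg Subtype.val (LinearMap.congr_fun hs y)
  let r : (ι → ℤ) →ₗ[ℤ] LinearMap.ker φ :=
    (LinearMap.id - s ∘ₗ φ.rangeRestrict).codRestrict _ fun v => by simp [hs']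
  have hr : ∀ v : LinearMap.ker φ, r v = v := fun v => by
    have : φ.rangeRestrict v = 0 := Subtype.ext v.2
    ext1
    simp [r, this]
  refine ⟨_, b, fun j => b.coord j ∘ₗ r, fun i j => ?_⟩
  simp [hr, Finsupp.single_apply]

/-- Homomorphisms to the divisible group `ℂ^*` extend: a homomorphism that vanishes on the kernel
of `φ` factors through `φ`. -/
theorem exists_linearMap_comp_eq {M N : Type*} [AddCommGroup M] [AddCommGroup N]
    (φ : M →ₗ[ℤ] N) (ψ : M →ₗ[ℤ] Additive ℂˣ) (h : LinearMap.ker φ ≤ LinearMap.ker ψ) :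
    ∃ χ : N →ₗ[ℤ] Additive ℂˣ, χ ∘ₗ φ = ψ := by
  have hsurj : ∀ {m : ℤ}, m ≠ 0 → Function.Surjective fun a : Additive ℂˣ => m • a := by
    have hnat : ∀ d : ℕ, d ≠ 0 → ∀ a : Additive ℂˣ, ∃ z, d • z = a := fun d hd a => by
      obtain ⟨z, hz⟩ :=
        IsAlgClosed.exists_pow_nat_eq (a.toMul : ℂ) (Nat.pos_of_ne_zero hd)
      have hz0 : z ≠ 0 := by
        rintro rfl
        rw [zero_pow hd] at hz
        exact a.toMul.ne_zero hz.symm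
      exact ⟨Additive.ofMul (Units.mk0 z hz0),
        Additive.toMul.injective (Units.ext (by simpa using hz))⟩
    intro m hm a
    obtain ⟨z, hz⟩ := hnat m.natAbs (Int.natAbs_ne_zero.2 hm) a
    rcases Int.natAbs_eq m with h | h
    · refine ⟨z, ?_⟩
      dsimp only
      rw [h, natCast_zsmul, hz]
    · refine ⟨-z, ?_⟩
      dsimp only
      rw [h, neg_smul_neg, natCast_zsmul, hz]
  let _ : DivisibleBy (Additive ℂˣ) ℤ := divisibleByOfSMulRightSurj _ _ hsurj
  -- A divisible group is injective, so the map induced by `ψ` on `M / ker φ` extends along the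
  -- embedding of this quotient into `N`.
  obtain ⟨χ, hχ⟩ := (Module.Baer.of_divisible (Additive ℂˣ)).extension_property
    ((LinearMap.ker φ).liftQ φ le_rfl)
    (LinearMap.ker_eq_bot.1 (Submodule.ker_liftQ_eq_bot _ _ _ le_rfl))
    ((LinearMap.ker φ).liftQ ψ h)
  refine ⟨χ, LinearMap.ext fun v => ?_⟩
  exact LinearMap.congr_fun hχ ((LinearMap.ker φ).mkQ v)

end Lattice

variable {n k : ℕ} {σ : Finset (KSubset n k)}

/-- The weight of the `I`-th Plücker coordinate for the torus `(ℂ^*)ⁿ` and the scalars. -/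
def bidegree (I : KSubset n k) : (Fin n → ℤ) × ℤ := (fun i => if i ∈ I.1 then 1 else 0, 1)

/-- The weight of a Laurent monomial in the Plücker coordinates. -/
def monomialDegree (σ : Finset (KSubset n k)) : (σ → ℤ) →ₗ[ℤ] (Fin n → ℤ) × ℤ :=
  Fintype.linearCombination ℤ fun I : σ => bidegree I.1

/-- The value at `q` of Laurent monomials, as a function of the exponents. -/
def laurentHom (q : σ → ℂˣ) : (σ → ℤ) →ₗ[ℤ] Additive ℂˣ :=
  Fintype.linearCombination ℤ fun I => Additive.ofMul (q I)

theorem laurentHom_apply (q : σ → ℂˣ) (v : σ → ℤ) :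
    laurentHom q v = Additive.ofMul (∏ I, q I ^ v I) := by
  simp [laurentHom, Fintype.linearCombination_apply, ofMul_prod]

theorem map_bidegree {A : Type*} [AddCommGroup A] (χ : (Fin n → ℤ) × ℤ →ₗ[ℤ] A)
    (I : KSubset n k) :
    χ (bidegree I) = ∑ i ∈ I.1, χ (Pi.single i 1, 0) + χ (0, 1) := by
  classical
  have : bidegree I = ∑ i ∈ I.1, ((Pi.single i 1 : Fin n → ℤ), (0 : ℤ)) + (0, 1) := by
    refine Prod.ext ?_ ?_
    · ext j
      simp [bidegree, Prod.fst_sum, Pi.single_apply]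
    · simp [bidegree, Prod.snd_sum]
  rw [this, map_add, map_sum]

/-- The scalar by which an element of the torus acts on a Plücker coordinate. -/
def unitCharacter (t : AlgTorus n) (I : KSubset n k) : ℂˣ := ∏ i ∈ I.1, t i

theorem coe_unitCharacter (t : AlgTorus n) (I : KSubset n k) :
    (unitCharacter t I : ℂ) = character t I := by
  simp [unitCharacter, character]

/-- The pair `(t, c)` is a homomorphism `χ` on weights, and the two Laurent values differ by `χ
(monomialDegree σ v)`. -/
theorem laurentHom_eq_of_proportional (q q' : σ → ℂˣ) (t : AlgTorus n) (c : ℂˣ)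
    (h : ∀ I, q' I = c * unitCharacter t I.1 * q I) (v : σ → ℤ) (hv : monomialDegree σ v = 0) :
    laurentHom q' v = laurentHom q v := by
  let χ : (Fin n → ℤ) × ℤ →ₗ[ℤ] Additive ℂˣ :=
    (Fintype.linearCombination ℤ fun i => Additive.ofMul (t i)).coprod
      (LinearMap.toSpanSingleton ℤ _ (Additive.ofMul c))
  have hχ : ∀ I : σ, Additive.ofMul (q' I) = χ (bidegree I.1) + Additive.ofMul (q I) := fun I => by
    rw [map_bidegree, h]
    simp [χ, unitCharacter, ofMul_prod, Fintype.linearCombination_apply_single, add_comm]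
  have h0 := congrArg χ hv
  simp only [monomialDegree, Fintype.linearCombination_apply, map_sum, map_smul, map_zero] at h0
  simp only [laurentHom, Fintype.linearCombination_apply, hχ, smul_add, Finset.sum_add_distrib,
    h0, zero_add]

/-- The quotient of the two evaluations kills the kernel of the degree map, hence factors through
weights; the factor's values on the standard basis are `t` and `c`. -/
theorem exists_proportional_of_laurentHom_eq (q q' : σ → ℂˣ)
    (h : ∀ v, monomialDegree σ v = 0 → laurentHom q' v = laurentHom q v) :
    ∃ (t : AlgTorus n) (c : ℂˣ), ∀ I, q' I = c * unitCharacter t I.1 * q I := by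
  classical
  obtain ⟨χ, hχ⟩ := exists_linearMap_comp_eq (monomialDegree σ) (laurentHom q' - laurentHom q)
    fun v hv => by
      rw [LinearMap.mem_ker] at hv ⊢
      rw [LinearMap.sub_apply, h v hv, sub_self]
  refine ⟨fun i => (χ (Pi.single i 1, 0)).toMul, (χ (0, 1)).toMul, fun I => ?_⟩
  have hI := LinearMap.congr_fun hχ (Pi.single I 1)
  simp only [LinearMap.comp_apply, monomialDegree, LinearMap.sub_apply, laurentHom,
    Fintype.linearCombination_apply_single, one_smul] at hI
  rw [map_bidegree, eq_sub_iff_add_eq] at hI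
  apply Additive.ofMul.injective
  rw [← hI]
  simp [unitCharacter, ofMul_prod, add_comm]

/-- A system of Laurent monomials of weight zero, and a monomial section. -/
theorem exists_monomials (σ : Finset (KSubset n k)) :
    ∃ (m : ℕ) (ω : Fin m → σ → ℤ) (a : σ → Fin m → ℕ),
      (∀ j, monomialDegree σ (ω j) = 0) ∧
      (∀ i j, ∑ I, ω i I * (a I j : ℤ) = if i = j then 1 else 0) ∧
      ∀ q q' : σ → ℂˣ, (∀ j, laurentHom q' (ω j) = laurentHom q (ω j)) →
        ∀ v, monomialDegree σ v = 0 → laurentHom q' v = laurentHom q v := by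
  classical
  obtain ⟨m, b, l, hl⟩ := exists_basis_ker (monomialDegree σ)
  -- A common shift making all exponents of the section nonnegative. It does not affect the pairing
  -- with `ω`, because degree zero in the scalar component forces `∑ I, ω j I = 0`.
  let B : ℕ := ∑ I : σ, ∑ j, (l j (Pi.single I 1)).natAbs
  have hB : ∀ I j, 0 ≤ l j (Pi.single I 1) + B := fun I j => by
    have h1 : (l j (Pi.single I 1)).natAbs ≤ ∑ j, (l j (Pi.single I 1)).natAbs :=
      Finset.single_le_sum (f := fun j => (l j (Pi.single I 1)).natAbs)
        (fun _ _ => Nat.zero_le _) (Finset.mem_univ j)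
    have h2 : ∑ j, (l j (Pi.single I 1)).natAbs ≤ B :=
      Finset.single_le_sum (f := fun I : σ => ∑ j, (l j (Pi.single I 1)).natAbs)
        (fun _ _ => Nat.zero_le _) (Finset.mem_univ I)
    omega
  have hdeg : ∀ j, monomialDegree σ (b j : σ → ℤ) = 0 := fun j => (b j).2
  refine ⟨m, fun j => b j, fun I j => (l j (Pi.single I 1) + B).toNat, hdeg, fun i j => ?_,
    fun q q' h v hv => ?_⟩
  · have hsum : ∑ I, (b i : σ → ℤ) I = 0 := by
      have := congrArg Prod.snd (hdeg i)
      simpa only [monomialDegree, Fintype.linearCombination_apply, Prod.snd_sum, Prod.smul_snd,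
        bidegree, smul_eq_mul, mul_one, Prod.snd_zero] using this
    have hlin : l j (b i) = ∑ I, (b i : σ → ℤ) I * l j (Pi.single I 1) := by
      conv_lhs => rw [pi_eq_sum_univ' (b i : σ → ℤ), map_sum]
      exact Finset.sum_congr rfl fun I _ => by rw [map_smul, smul_eq_mul]
    simp only [Int.toNat_of_nonneg (hB _ _), mul_add, Finset.sum_add_distrib, ← Finset.sum_mul,
      hsum, zero_mul, add_zero]
    rw [← hlin, hl]
  · have hv' := congrArg Subtype.val (b.sum_repr ⟨v, hv⟩)
    simp only [Submodule.coe_sum, Submodule.coe_smul] at hv'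
    rw [← hv', map_sum, map_sum]
    exact Finset.sum_congr rfl fun j _ => by rw [map_smul, map_smul, h]

end

/-! ### The parameter space as an algebraic variety -/

section

variable {n k m : ℕ} {σ : Finset (KSubset n k)}

/-- The values at `p` of the Laurent monomials with exponents `ω`. -/
def laurentMap (ω : Fin m → σ → ℤ) (p : KSubset n k → ℂ) : Fin m → ℂ :=
  fun j => ∏ I : σ, p I.1 ^ ω j I

theorem laurentMap_apply_eq (ω : Fin m → σ → ℤ) (p : KSubset n k → ℂ) (q : σ → ℂˣ)
    (h : ∀ I : σ, (q I : ℂ) = p I.1) (j : Fin m) :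
    laurentMap ω p j = ((laurentHom q (ω j)).toMul : ℂ) := by
  simp [laurentMap, laurentHom_apply, ← h]

theorem laurentMap_eq_of_proportional (ω : Fin m → σ → ℤ) (hω : ∀ j, monomialDegree σ (ω j) = 0)
    (p p' : KSubset n k → ℂ) (hp : ∀ I ∈ σ, p I ≠ 0) (t : AlgTorus n) (c : ℂ) (hc : c ≠ 0)
    (h : ∀ I ∈ σ, p' I = c * character t I * p I) : laurentMap ω p' = laurentMap ω p := by
  let q : σ → ℂˣ := fun I => Units.mk0 (p I.1) (hp I.1 I.2)
  let q' : σ → ℂˣ := fun I => Units.mk0 c hc * unitCharacter t I.1 * q I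
  ext j
  rw [laurentMap_apply_eq ω p q (fun I => rfl) j, laurentMap_apply_eq ω p' q' (fun I => ?_) j,
    laurentHom_eq_of_proportional q q' t (Units.mk0 c hc) (fun I => rfl) (ω j) (hω j)]
  rw [h I.1 I.2, ← coe_unitCharacter]
  rfl

/-- The vector of monomials with exponents `a`, with the value `0` outside `σ`. -/
def monomialVector {R : Type*} [CommRing R] (a : σ → Fin m → ℕ) (c : Fin m → R)
    (I : KSubset n k) : R :=
  if h : I ∈ σ then ∏ j, c j ^ a ⟨I, h⟩ j else 0

theorem monomialVector_ne_zero_iff (a : σ → Fin m → ℕ) (c : Fin m → ℂ) (hc : ∀ j, c j ≠ 0)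
    (I : KSubset n k) : monomialVector a c I ≠ 0 ↔ I ∈ σ := by
  by_cases h : I ∈ σ
  · simp [monomialVector, h, Finset.prod_eq_zero_iff, hc]
  · simp [monomialVector, h]

theorem map_monomialVector {R S : Type*} [CommRing R] [CommRing S] (φ : R →+* S)
    (a : σ → Fin m → ℕ) (c : Fin m → R) (I : KSubset n k) :
    φ (monomialVector a c I) = monomialVector a (fun j => φ (c j)) I := by
  by_cases h : I ∈ σ
  · simp [monomialVector, h]
  · simp [monomialVector, h]

theorem continuous_monomialVector (a : σ → Fin m → ℕ) (I : KSubset n k) :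
    Continuous fun c : Fin m → ℂ => monomialVector a c I := by
  by_cases h : I ∈ σ
  · simp only [monomialVector, h, dite_true]
    fun_prop
  · simp only [monomialVector, h, dite_false]
    exact continuous_const

/-- The exponent of `c j` in the `i`-th value is `∑ I, ω i I * a I j`, which is `1` if `i = j` and
`0` otherwise. -/
theorem laurentMap_monomialVector (ω : Fin m → σ → ℤ) (a : σ → Fin m → ℕ)
    (ha : ∀ i j, ∑ I, ω i I * (a I j : ℤ) = if i = j then 1 else 0) (c : Fin m → ℂ)
    (hc : ∀ j, c j ≠ 0) : laurentMap ω (monomialVector a c) = c := by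
  let u : Fin m → ℂˣ := fun j => Units.mk0 (c j) (hc j)
  ext i
  rw [laurentMap_apply_eq ω _ (fun I => ∏ j, u j ^ a I j) (fun I => by simp [monomialVector, u])]
  have h : laurentHom (fun I => ∏ j, u j ^ a I j) (ω i) = Additive.ofMul (u i) := by
    have h1 : ∀ I, Additive.ofMul (∏ j, u j ^ a I j) =
        ∑ j, (a I j : ℤ) • Additive.ofMul (u j) := fun I => by
      simp [ofMul_prod]
    simp only [laurentHom, Fintype.linearCombination_apply, h1, Finset.smul_sum, smul_smul]
    rw [Finset.sum_comm]
    have h2 : ∀ j, ∑ I, (ω i I * (a I j : ℤ)) • Additive.ofMul (u j) =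
        (if i = j then 1 else 0 : ℤ) • Additive.ofMul (u j) := fun j => by
      rw [← ha i j]
      exact (Finset.sum_smul (R := ℤ) (M := Additive ℂˣ)).symm
    simp only [h2, ite_smul, one_smul, zero_smul, Finset.sum_ite_eq, Finset.mem_univ, if_true]
  rw [h]
  rfl

/-- The equation expressing that the `J`-th entry of the vector of monomials is the `J`-th Plücker
coordinate of the subspace reconstructed from its chart with respect to `I`. -/
def chartEquation (a : σ → Fin m → ℕ) (I J : KSubset n k) : MvPolynomial (Fin m) ℂ :=
  ((chartMatrix I (monomialVector a MvPolynomial.X)).submatrix (J.1.orderEmbOfFin J.2) id).det *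
    monomialVector a MvPolynomial.X I -
  monomialVector a MvPolynomial.X J * monomialVector a MvPolynomial.X I ^ k

theorem eval_chartEquation (a : σ → Fin m → ℕ) (I J : KSubset n k) (c : Fin m → ℂ) :
    MvPolynomial.eval c (chartEquation a I J) =
      plucker (chartMatrix I (monomialVector a c)) J * monomialVector a c I -
        monomialVector a c J * monomialVector a c I ^ k := by
  have h : ∀ I : KSubset n k, MvPolynomial.eval c (monomialVector a MvPolynomial.X I) =
      monomialVector a c I := fun I => by
    simp [map_monomialVector]
  have hM : (chartMatrix I (monomialVector (R := MvPolynomial (Fin m) ℂ) a MvPolynomial.X)).map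
      (MvPolynomial.eval c) = chartMatrix I (monomialVector a c) := by
    rw [chartMatrix_map]
    simp only [h]
  rw [chartEquation, map_sub, map_mul, map_mul, map_pow, h, h, RingHom.map_det, plucker, ← hM]
  rfl

theorem mem_openAlgebraicSubset_chartEquation (a : σ → Fin m → ℕ) (I : KSubset n k)
    (c : Fin m → ℂ) :
    c ∈ openAlgebraicSubset m (Set.range (chartEquation a I)) 1 ↔ (∀ j, c j ≠ 0) ∧
      ∀ J, plucker (chartMatrix I (monomialVector a c)) J * monomialVector a c I =
        monomialVector a c J * monomialVector a c I ^ k := by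
  have h : c ∈ openAlgebraicSubset m (Set.range (chartEquation a I)) 1 ↔ (∀ j, c j ≠ 0) ∧
      (∀ f ∈ Set.range (chartEquation a I), MvPolynomial.eval c f = 0) ∧
      MvPolynomial.eval c 1 ≠ 0 := Iff.rfl
  rw [h, Set.forall_mem_range]
  simp only [eval_chartEquation, sub_eq_zero, map_one, ne_eq, one_ne_zero, not_false_eq_true,
    and_true]

/-- The chosen frame of `L` need not vary continuously, but monomials of weight zero have the same
value on every frame, so continuity is checked on frames. Negative exponents are harmless since the
coordinates in `σ` do not vanish. -/
theorem continuous_laurentMap (ω : Fin m → σ → ℤ) (hω : ∀ j, monomialDegree σ (ω j) = 0) :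
    Continuous fun L : stratum σ => laurentMap ω (plucker L.1.frame.1) := by
  have hq : IsOpenQuotientMap ((stratum σ : Set (Gr n k)).restrictPreimage Frame.span) :=
    Frame.isOpenQuotientMap_span.restrictPreimage _
  refine hq.isQuotientMap.continuous_iff.2 ?_
  have h : Continuous fun A : Frame.span ⁻¹' (stratum σ : Set (Gr n k)) =>
      laurentMap ω (plucker A.1.1) := by
    refine continuous_pi fun j => continuous_finsetProd _ fun I _ => ?_
    refine Continuous.zpow₀ ?_ _ fun A => Or.inl (((span_mem_stratum σ A.1).1 A.2 I.1).2 I.2)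
    exact (continuous_plucker I.1).comp (continuous_subtype_val.comp continuous_subtype_val)
  convert h using 1
  funext A
  obtain ⟨c, hc, hpl⟩ := plucker_unique A.1.span.frame A.1 (Gr.span_frame _)
  refine laurentMap_eq_of_proportional ω hω _ _
    (fun I hI => ((span_mem_stratum σ A.1).1 A.2 I).2 hI) 1 c hc fun I _ => ?_
  change plucker A.1.span.frame.1 I = _
  rw [hpl]
  simp [character, mul_comm]

theorem laurentMap_smul (ω : Fin m → σ → ℤ) (hω : ∀ j, monomialDegree σ (ω j) = 0)
    (L : stratum σ) (t : AlgTorus n) :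
    laurentMap ω (plucker (t • L).1.frame.1) = laurentMap ω (plucker L.1.frame.1) := by
  obtain ⟨c, hc, hpl⟩ := exists_plucker_smul_frame t L.1
  refine laurentMap_eq_of_proportional ω hω _ _ (fun I hI => (L.2 I).2 hI) t c hc fun I _ => ?_
  refine (hpl I).trans ?_
  ring

theorem laurentMap_span (ω : Fin m → σ → ℤ) (hω : ∀ j, monomialDegree σ (ω j) = 0) (A : Frame n k)
    (hA : A.span ∈ stratum σ) :
    laurentMap ω (plucker A.span.frame.1) = laurentMap ω (plucker A.1) := by
  obtain ⟨c, hc, hpl⟩ := plucker_unique A.span.frame A (Gr.span_frame _)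
  refine laurentMap_eq_of_proportional ω hω _ _
    (fun I hI => ((span_mem_stratum σ A).1 hA I).2 hI) 1 c hc fun I _ => ?_
  rw [hpl]
  simp [character, mul_comm]

/-- The map on the space of parameters induced by Laurent monomials. -/
def paramMap (ω : Fin m → σ → ℤ) (hω : ∀ j, monomialDegree σ (ω j) = 0) :
    ParamSpace σ → Fin m → ℂ :=
  Quotient.lift (fun L : stratum σ => laurentMap ω (plucker L.1.frame.1)) (by
    rintro _ L ⟨t, rfl⟩
    exact laurentMap_smul ω hω L t)

/-- If Laurent monomials separate torus orbits, two vectors of Plücker coordinates with the same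
monomials differ by a torus element and a scalar. -/
theorem exists_proportional_of_laurentMap_eq (ω : Fin m → σ → ℤ)
    (hsep : ∀ q q' : σ → ℂˣ, (∀ j, laurentHom q' (ω j) = laurentHom q (ω j)) →
      ∀ v, monomialDegree σ v = 0 → laurentHom q' v = laurentHom q v)
    (p p' : KSubset n k → ℂ) (hp : ∀ I, p I ≠ 0 ↔ I ∈ σ) (hp' : ∀ I, p' I ≠ 0 ↔ I ∈ σ)
    (h : laurentMap ω p' = laurentMap ω p) :
    ∃ (t : AlgTorus n) (c : ℂ), c ≠ 0 ∧ ∀ I, p' I = c * (character t I * p I) := by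
  let q : σ → ℂˣ := fun I => Units.mk0 (p I.1) ((hp I.1).2 I.2)
  let q' : σ → ℂˣ := fun I => Units.mk0 (p' I.1) ((hp' I.1).2 I.2)
  obtain ⟨t, c, htc⟩ := exists_proportional_of_laurentHom_eq q q' (hsep q q' fun j => by
    have := congrFun h j
    rw [laurentMap_apply_eq ω p q (fun I => rfl),
      laurentMap_apply_eq ω p' q' (fun I => rfl)] at this
    exact Additive.toMul.injective (Units.ext this))
  refine ⟨t, c, c.ne_zero, fun I => ?_⟩
  by_cases hI : I ∈ σ
  · have := congrArg (Units.val) (htc ⟨I, hI⟩)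
    simpa [q, q', coe_unitCharacter, mul_assoc] using this
  · rw [not_not.1 (mt (hp I).1 hI), not_not.1 (mt (hp' I).1 hI)]
    simp

/-- The space of parameters is an open algebraic variety. -/
theorem exists_homeomorph_openAlgebraicSubset (hσ : ∃ L : Gr n k, L ∈ stratum σ) :
    ∃ (m : ℕ) (S : Set (MvPolynomial (Fin m) ℂ)) (g : MvPolynomial (Fin m) ℂ)
      (ω : Fin m → σ → ℤ) (e : ParamSpace σ ≃ₜ openAlgebraicSubset m S g),
      ∀ (A : Frame n k) (hA : A.span ∈ stratum σ),
        (e (Quotient.mk _ ⟨A.span, hA⟩)).1 = laurentMap ω (plucker A.1) := by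
  obtain ⟨m, ω, a, hω, ha, hsep⟩ := exists_monomials σ
  obtain ⟨I₀, hI₀⟩ := nonempty_of_mem_stratum hσ.choose_spec
  -- No further inequality than `c j ≠ 0` is needed: it already makes the monomial vector nonzero
  -- exactly on `σ`. Hence `g = 1`.
  let Z := openAlgebraicSubset m (Set.range (chartEquation a I₀)) 1
  have hZ := mem_openAlgebraicSubset_chartEquation a I₀
  have hmem : ∀ x, paramMap ω hω x ∈ Z := fun x => by
    induction x using Quotient.inductionOn with | h L => ?_
    have hne : ∀ j, laurentMap ω (plucker L.1.frame.1) j ≠ 0 := fun j =>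
      Finset.prod_ne_zero_iff.2 fun I _ => zpow_ne_zero _ ((L.2 I.1).2 I.2)
    refine (hZ _).2 ⟨hne, fun J => ?_⟩
    -- The monomial vector has the same Laurent values as the Plücker vector of `L`, so it is a
    -- multiple of the Plücker vector of a torus translate and satisfies the chart equations.
    obtain ⟨t, d, hd, htd⟩ := exists_proportional_of_laurentMap_eq ω hsep _ _ L.2
      (monomialVector_ne_zero_iff a _ hne) (laurentMap_monomialVector ω a ha _ hne)
    have hvec : monomialVector a (laurentMap ω (plucker L.1.frame.1)) =
        fun J => plucker (L.1.frame.scale t).1 J * d := by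
      funext J
      rw [htd, plucker_scale, prod_orderEmbOfFin J fun i => (t i : ℂ), character]
      ring
    change plucker (chartMatrix I₀ (monomialVector a (laurentMap ω (plucker L.1.frame.1)))) J *
      monomialVector a (laurentMap ω (plucker L.1.frame.1)) I₀ =
      monomialVector a (laurentMap ω (plucker L.1.frame.1)) J *
      monomialVector a (laurentMap ω (plucker L.1.frame.1)) I₀ ^ k
    rw [hvec]
    exact plucker_chartMatrix _ d I₀ J
  let f : ParamSpace σ → Z := fun x => ⟨paramMap ω hω x, hmem x⟩
  have hf : Continuous f :=
    ((continuous_laurentMap ω hω).quotient_lift _).subtype_mk _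
  have hinj : Function.Injective f := by
    intro x y hxy
    induction x using Quotient.inductionOn with | h L => ?_
    induction y using Quotient.inductionOn with | h L' => ?_
    obtain ⟨t, c, -, htc⟩ := exists_proportional_of_laurentMap_eq ω hsep _ _ L'.2 L.2
      (congrArg Subtype.val hxy)
    exact Quotient.sound ⟨t, Subtype.ext (smul_eq_of_character t c htc)⟩
  have hne : ∀ c : Z, monomialVector a c.1 I₀ ≠ 0 := fun c =>
    (monomialVector_ne_zero_iff a c.1 ((hZ c.1).1 c.2).1 I₀).2 hI₀
  have hpl : ∀ (c : Z) (J : KSubset n k),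
      plucker ((monomialVector a c.1 I₀)⁻¹ • chartMatrix I₀ (monomialVector a c.1)) J =
        monomialVector a c.1 J * (monomialVector a c.1 I₀)⁻¹ := fun c =>
    plucker_inv_smul_chartMatrix _ I₀ (hne c) ((hZ c.1).1 c.2).2
  -- The frame normalised in the chart `I₀`; its Plücker vector is the monomial vector divided by
  -- its `I₀`-entry.
  let F : Z → Frame n k := fun c =>
    ⟨(monomialVector a c.1 I₀)⁻¹ • chartMatrix I₀ (monomialVector a c.1),
      linearIndependent_col_of_plucker_ne_zero _ I₀ (by simp [hpl, hne c])⟩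
  have hFmem : ∀ c, (F c).span ∈ stratum σ := fun c => (span_mem_stratum σ _).2 fun I => by
    rw [← monomialVector_ne_zero_iff a c.1 ((hZ c.1).1 c.2).1 I]
    simp [F, hpl, hne c]
  have hFcont : Continuous F := by
    have hv : ∀ J, Continuous fun c : Z => monomialVector a c.1 J := fun J =>
      (continuous_monomialVector a J).comp continuous_subtype_val
    refine Continuous.subtype_mk (((hv I₀).inv₀ hne).smul (continuous_matrix fun j i => ?_)) _
    simp only [chartMatrix, Matrix.of_apply]
    exact continuous_finsetSum _ fun J _ => continuous_const.mul (hv J)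
  let s : Z → ParamSpace σ := fun c => Quotient.mk _ ⟨(F c).span, hFmem c⟩
  have hs : Continuous s :=
    continuous_quot_mk.comp ((Frame.continuous_span.comp hFcont).subtype_mk _)
  have hfs : ∀ c, f (s c) = c := fun c => Subtype.ext <| by
    have h1 : laurentMap ω (plucker (F c).span.frame.1) = laurentMap ω (plucker (F c).1) :=
      laurentMap_span ω hω (F c) (hFmem c)
    have h2 : laurentMap ω (plucker (F c).1) = laurentMap ω (monomialVector a c.1) := by
      refine laurentMap_eq_of_proportional ω hω _ _
        (fun I hI => (monomialVector_ne_zero_iff a c.1 ((hZ c.1).1 c.2).1 I).2 hI) 1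
        _ (inv_ne_zero (hne c)) fun I _ => ?_
      rw [hpl]
      simp [character, mul_comm]
    exact h1.trans (h2.trans (laurentMap_monomialVector ω a ha c.1 ((hZ c.1).1 c.2).1))
  refine ⟨m, _, _, ω, ⟨⟨f, s, fun x => hinj (hfs (f x)), hfs⟩, hf, hs⟩, fun A hA => ?_⟩
  exact laurentMap_span ω hω A hA

end

end GrassmannTorus

end
open GrassmannTorus in
theorem mainTheorem6 (n k : ℕ) (σ : Finset (KSubset n k))
    (hσ : ∃ L : Gr n k, L ∈ stratum σ) :
    -- the induced moment map takes its values in the open polytope, and with that target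
    ∃ hμ : ∀ x : OrbitSpace σ, momentHat σ x ∈ openPolytope σ,
      -- it is a locally trivial bundle with fiber the space of parameters
      (∀ y : openPolytope σ,
        ∃ e : Bundle.Trivialization (ParamSpace σ)
            (fun x : OrbitSpace σ => (⟨momentHat σ x, hμ x⟩ : openPolytope σ)),
          y ∈ e.baseSet) ∧
      -- the canonical trivialization
      IsHomeomorph (fun x : OrbitSpace σ =>
        ((⟨momentHat σ x, hμ x⟩, paramProj σ x) : openPolytope σ × ParamSpace σ)) ∧
      -- the fiber is an open algebraic variety, embedded by Laurent monomials
      ∃ (m : ℕ) (S : Set (MvPolynomial (Fin m) ℂ)) (g : MvPolynomial (Fin m) ℂ)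
        (ω : Fin m → KSubset n k → ℤ) (e : ParamSpace σ ≃ₜ openAlgebraicSubset m S g),
        ∀ (A : Frame n k) (hA : A.span ∈ stratum σ) (j : Fin m),
          (e (Quotient.mk _ ⟨A.span, hA⟩)).1 j = ∏ I ∈ σ, plucker A.1 I ^ ω j I := by
  classical
  refine ⟨momentHat_mem, fun y => ?_, isHomeomorph_orbitToProd, ?_⟩
  · exact ⟨trivializationOfHomeomorph isHomeomorph_orbitToProd.homeomorph, Set.mem_univ y⟩
  · obtain ⟨m, S, g, ω, e, he⟩ := exists_homeomorph_openAlgebraicSubset hσ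
    -- The exponents outside `σ` are immaterial, as the product runs over `σ` only.
    refine ⟨m, S, g, fun j I => if h : I ∈ σ then ω j ⟨I, h⟩ else 0, e, fun A hA j => ?_⟩
    rw [he, laurentMap, ← Finset.prod_coe_sort σ]
    exact Finset.prod_congr rfl fun I _ => by simp
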